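/- Let $\mathbb{C}^\times$ be the multiplicative group of nonzero complex numbers and $\mathbb{Z}_2=\mathbb{Z}/2\mathbb{Z}$. A Lie conformal superalgebra is a $\mathbb{Z}_2$-graded $\mathbb{C}[\partial]$-module $R=R_{\bar 0}\oplus R_{\bar 1}$ with a $\mathbb{C}$-linear, grading-compatible $\lambda$-bracket $R\otimes R\to\mathbb{C}[\lambda]\otimes R$, $a\otimes b\mapsto[a_\lambda b]$, such that $[\partial a_\lambda b]=-\lambda[a_\lambda b]$, $[a_\lambda\partial b]=(\partial+\lambda)[a_\lambda b]$, $[a_\lambda b]=-(-1)^{|a||b|}[b_{-\lambda-\partial}a]$ and $[a_\lambda[b_\mu c]]=[[a_\lambda b]_{\lambda+\mu}c]+(-1)^{|a||b|}[b_\mu[a_\lambda c]]$. Its automorphism group $\mathrm{Aut}(R)$ consists of the grading-preserving $\mathbb{C}$-linear bijections $\sigma:R\to R$ with $\sigma\partial=\partial\sigma$ and $\sigma([a_\lambda b])=[\sigma(a)_\lambda\sigma(b)]$, under composition. A polynomial $f(x,y)$ is skew-symmetric if $f(x,y)=-f(x,-x-y)$. Consider the following Lie conformal superalgebras of rank $(2+1)$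 on the free module $\mathbb{C}[\partial]A\oplus\mathbb{C}[\partial]B\oplus\mathbb{C}[\partial]X$ with $A,B$ even and $X$ odd (brackets of generators not listed vanish or are given by skew-symmetry): * $\mathcal{A}_1$: $[A_\lambda A]=f_1(\partial,\lambda)B$, $[A_\lambda X]=\phi_1(\lambda)X$, with $f_1\in\mathbb{C}[\partial,\lambda]$ nonzero skew-symmetric, $\phi_1\in\mathbb{C}[\lambda]$; * $\mathcal{A}_2$: $[A_\lambda A]=f_2(\partial,\lambda)B$, $[X_\lambda X]=\psi(\partial)B$, with $f_2\in\mathbb{C}[\partial,\lambda]$ nonzero skew-symmetric, $\psi\in\mathbb{C}[\partial]$; * $\mathcal{A}_3$: $[A_\lambda B]=2\phi_3(\lambda)B$, $[A_\lambda X]=\phi_3(\lambda)X$, $[X_\lambda X]=2B$, with $0\ne\phi_3\in\mathbb{C}[\lambda]$; * $\mathcal{A}_4$: $[A_\lambda B]=p(\lambda)B$, $[A_\lambda X]=\phi_4(\lambda)X$, with $0\ne p\in\mathbb{C}[\lambda]$, $\phi_4\in\mathbb{C}[\lambda]$; * $\mathcal{B}_1$: $[A_\lambda A]=(\partial+2\lambda)A$,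 $[B_\lambda B]=(\partial+2\lambda)B$, $[A_\lambda X]=(\partial+\alpha\lambda+\beta)X$, with $\alpha,\beta\in\mathbb{C}$; * $\mathcal{B}_2$: $[A_\lambda A]=(\partial+2\lambda)A$, $[B_\lambda B]=(\partial+2\lambda)B$, $[A_\lambda X]=(\partial+\frac32\lambda)X$, $[X_\lambda X]=2A$; * $\mathcal{C}_1$: $[A_\lambda A]=(\partial+2\lambda)A$, $[A_\lambda X]=(\partial+\alpha\lambda+\beta)X$, with $\alpha,\beta\in\mathbb{C}$; * $\mathcal{C}_2$: $[A_\lambda A]=(\partial+2\lambda)A$, $[A_\lambda X]=(\partial+\frac32\lambda)X$, $[X_\lambda X]=2A$; * $\mathcal{C}_3$: $[A_\lambda A]=(\partial+2\lambda)A$, $[B_\lambda X]=\varphi(\lambda)X$, with $0\ne\varphi\in\mathbb{C}[\lambda]$. Then there are the following isomorphisms of groups, where $\mathbb{C}[\partial]$ and $\mathbb{C}$ are additive groups and $\mathbb{C}^\times$ acts on them in the semidirect products $\mathbb{C}^\times\ltimes\mathbb{C}[\partial]$ and $\mathbb{C}^\times\ltimes\mathbb{C}$ by scalar multiplication, except for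 $\mathcal{A}_3$, where $t\in\mathbb{C}^\times$ acts on $\mathbb{C}$ as multiplication by $t^2$: * $\mathrm{Aut}(\mathcal{A}_1)\cong(\mathbb{C}^\times\ltimes\mathbb{C}[\partial])\times\mathbb{C}^\times$ if $\phi_1=0$, and $\mathrm{Aut}(\mathcal{A}_1)\cong\mathbb{C}[\partial]\times\mathbb{C}^\times$ if $\phi_1\ne0$; * $\mathrm{Aut}(\mathcal{A}_2)\cong(\mathbb{C}^\times\ltimes\mathbb{C}[\partial])\times\mathbb{C}^\times$ if $\psi=0$, and $\mathrm{Aut}(\mathcal{A}_2)\cong(\mathbb{C}^\times\ltimes\mathbb{C}[\partial])\times\mathbb{Z}_2$ if $\psi\ne0$; * $\mathrm{Aut}(\mathcal{A}_3)\cong\mathbb{C}^\times\ltimes\mathbb{C}$ (with $t\cdot z=t^2z$); * $\mathrm{Aut}(\mathcal{A}_4)\cong(\mathbb{C}^\times\ltimes\mathbb{C})\times\mathbb{C}^\times$; * $\mathrm{Aut}(\mathcal{B}_1)\cong\mathbb{C}^\times$ and $\mathrm{Aut}(\mathcal{B}_2)\cong\mathbb{Z}_2$; * $\mathrm{Aut}(\mathcal{C}_1)\cong\mathbb{C}^\times\times\mathbb{C}^\times$,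 $\mathrm{Aut}(\mathcal{C}_2)\cong\mathbb{C}^\times\times\mathbb{Z}_2$ and $\mathrm{Aut}(\mathcal{C}_3)\cong\mathbb{C}^\times$. -/

import Mathlib

open Polynomial
open scoped Polynomial.Bivariate

set_option linter.unusedSimpArgs false

noncomputable section

/-! ### Lie conformal superalgebras

`ℂ[X]` plays the role of `ℂ[∂]`, so `X • a` is `∂a`.  An element `∑ₙ λⁿ rₙ` of `R[λ] = ℂ[λ] ⊗ R` is
stored as the finitely supported family `n ↦ rₙ` of its coefficients. -/

/-- The value `∑ₙ tⁿ rₙ` of `∑ₙ λⁿ rₙ ∈ R[λ]` at `λ = t`, where `t` is a complex number (written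
`C z`) or more generally an element of `ℂ[∂]`, such as `-z - ∂`. -/
def evalLambda {R : Type*} [AddCommGroup R] [Module ℂ[X] R] (t : ℂ[X]) (p : ℕ →₀ R) : R :=
  p.sum fun n r => t ^ n • r

/-- A polynomial in `λ` with coefficients in a complex vector space is determined by its values at
all complex numbers; hence an identity in `R[λ]` (or `R[λ, μ]`) can be stated on values. -/
theorem evalLambda_ext {R : Type*} [AddCommGroup R] [Module ℂ R] [Module ℂ[X] R]
    [IsScalarTower ℂ ℂ[X] R] {p q : ℕ →₀ R}
    (h : ∀ z : ℂ, evalLambda (C z) p = evalLambda (C z) q) : p = q := by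
  have key : ∀ (p : ℕ →₀ R) (f : Module.Dual ℂ R) (z : ℂ),
      f (evalLambda (C z) p) = (∑ n ∈ p.support, monomial n (f (p n))).eval z := by
    intro p f z
    rw [evalLambda, Finsupp.sum, map_sum, eval_finsetSum]
    refine Finset.sum_congr rfl fun n _ => ?_
    have h1 : (C z : ℂ[X]) ^ n • p n = z ^ n • p n := by
      rw [← C_pow, ← algebraMap_smul ℂ[X] (z ^ n) (p n)]; rfl
    rw [h1, map_smul, smul_eq_mul, eval_monomial, mul_comm]
  have hc : ∀ (p : ℕ →₀ R) (f : Module.Dual ℂ R) (n : ℕ),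
      (∑ n ∈ p.support, monomial n (f (p n))).coeff n = f (p n) := by
    intro p f n
    rw [finsetSum_coeff]
    simp only [coeff_monomial, Finset.sum_ite_eq']
    split_ifs with h0
    · rfl
    · rw [Finsupp.notMem_support_iff.1 h0, map_zero]
  ext n
  rw [← sub_eq_zero, ← Module.forall_dual_apply_eq_zero_iff ℂ]
  intro f
  have h2 : ∑ n ∈ p.support, monomial n (f (p n)) = ∑ n ∈ q.support, monomial n (f (q n)) := by
    apply Polynomial.funext
    intro z
    rw [← key, ← key, h z]
  rw [map_sub, ← hc p f n, h2, hc q f n, sub_self]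

/-- The sign `(-1)^{|a||b|}` for parities `|a| = i`, `|b| = j`. -/
def paritySign (i j : ZMod 2) : ℂ := (-1) ^ (i.val * j.val)

theorem paritySign_00 : paritySign 0 0 = 1 := by simp [paritySign]

theorem paritySign_01 : paritySign 0 1 = 1 := by simp [paritySign]

theorem paritySign_10 : paritySign 1 0 = 1 := by simp [paritySign]

theorem paritySign_11 : paritySign 1 1 = -1 := by simp [paritySign, ZMod.val_one]

/-- A Lie conformal superalgebra structure on a `ℂ[∂]`-module `R`.  With
`evalLambda (C z) (bracket a b)` for `[a_λ b]` at `λ = z`, the axioms are required for all complex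
values `z`, `w` of the formal variables `λ`, `μ`. -/
structure LieConformalSuperalgebra (R : Type*) [AddCommGroup R] [Module ℂ R] [Module ℂ[X] R]
    [IsScalarTower ℂ ℂ[X] R] where
  /-- The even part `grade 0` and the odd part `grade 1`. -/
  grade : ZMod 2 → Submodule ℂ[X] R
  isInternal : DirectSum.IsInternal grade
  /-- `bracket a b n` is the coefficient of `λⁿ` in `[a_λ b]`. -/
  bracket : R →ₗ[ℂ] R →ₗ[ℂ] (ℕ →₀ R)
  bracket_mem : ∀ (i j : ZMod 2), ∀ a ∈ grade i, ∀ b ∈ grade j, ∀ n, bracket a b n ∈ grade (i + j)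
  /-- `[∂a_λ b] = -λ [a_λ b]` -/
  sesqui_left : ∀ (a b : R) (z : ℂ),
    evalLambda (C z) (bracket ((X : ℂ[X]) • a) b) = -((C z : ℂ[X]) • evalLambda (C z) (bracket a b))
  /-- `[a_λ ∂b] = (∂ + λ) [a_λ b]` -/
  sesqui_right : ∀ (a b : R) (z : ℂ),
    evalLambda (C z) (bracket a ((X : ℂ[X]) • b)) = (X + C z : ℂ[X]) • evalLambda (C z) (bracket a b)
  /-- `[a_λ b] = -(-1)^{|a||b|} [b_{-λ-∂} a]` -/
  skew : ∀ (i j : ZMod 2), ∀ a ∈ grade i, ∀ b ∈ grade j, ∀ z : ℂ,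
    evalLambda (C z) (bracket a b) = -(paritySign i j • evalLambda (-C z - X) (bracket b a))
  /-- `[a_λ [b_μ c]] = [[a_λ b]_{λ+μ} c] + (-1)^{|a||b|} [b_μ [a_λ c]]` -/
  jacobi : ∀ (i j : ZMod 2), ∀ a ∈ grade i, ∀ b ∈ grade j, ∀ (c : R) (z w : ℂ),
    evalLambda (C z) (bracket a (evalLambda (C w) (bracket b c))) =
      evalLambda (C (z + w)) (bracket (evalLambda (C z) (bracket a b)) c) +
        paritySign i j • evalLambda (C w) (bracket b (evalLambda (C z) (bracket a c)))

theorem zmod_two_univ : (Set.univ : Set (ZMod 2)) = {0, 1} := by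
  ext x; revert x; simp only [Set.mem_univ, Set.mem_insert_iff, Set.mem_singleton_iff]; decide

/-- The automorphism group: the parity preserving `ℂ`-linear bijections `σ` with `σ∂ = ∂σ` (that is,
`ℂ[∂]`-linear bijections) and `σ [a_λ b] = [σ(a)_λ σ(b)]`, under composition. -/
def LieConformalSuperalgebra.Aut {R : Type*} [AddCommGroup R] [Module ℂ R] [Module ℂ[X] R]
    [IsScalarTower ℂ ℂ[X] R] (S : LieConformalSuperalgebra R) : Subgroup (R ≃ₗ[ℂ[X]] R) where
  carrier := {σ | (∀ i, ∀ a ∈ S.grade i, σ a ∈ S.grade i) ∧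
    ∀ a b n, σ (S.bracket a b n) = S.bracket (σ a) (σ b) n}
  one_mem' := ⟨fun _ _ h => h, fun _ _ _ => rfl⟩
  mul_mem' := by
    rintro σ τ ⟨h1, h2⟩ ⟨h3, h4⟩
    exact ⟨fun i a ha => h1 i _ (h3 i a ha), fun a b n => by
      simp only [LinearEquiv.mul_apply, h4, h2]⟩
  inv_mem' := by
    rintro σ ⟨h1, h2⟩
    have hc := (DirectSum.isInternal_submodule_iff_isCompl S.grade (i := 0) (j := 1)
      (by decide) zmod_two_univ).1 S.isInternal
    have hco : ∀ i : ZMod 2, IsCompl (S.grade i) (S.grade (i + 1)) := by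
      intro i
      fin_cases i
      · exact hc
      · exact hc.symm
    refine ⟨fun i a ha => ?_, fun a b n => ?_⟩
    · change σ.symm a ∈ _
      have ht : σ.symm a ∈ S.grade i ⊔ S.grade (i + 1) := by
        rw [(hco i).sup_eq_top]; trivial
      obtain ⟨x, hx, y, hy, hxy⟩ := Submodule.mem_sup.1 ht
      have e : σ x + σ y = a := by rw [← map_add, hxy, LinearEquiv.apply_symm_apply]
      have hy0 : σ y ∈ S.grade i := by
        have : σ y = a - σ x := by rw [← e]; abel
        rw [this]
        exact Submodule.sub_mem _ ha (h1 i x hx)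
      have : σ y = 0 := Submodule.disjoint_def.1 (hco i).disjoint _ hy0 (h1 _ y hy)
      have hy' : y = 0 := by simpa using this
      rw [← hxy, hy', add_zero]; exact hx
    · change σ.symm _ = S.bracket (σ.symm a) (σ.symm b) n
      rw [LinearEquiv.symm_apply_eq, h2, LinearEquiv.apply_symm_apply, LinearEquiv.apply_symm_apply]

/-! ### Free Lie conformal superalgebras from structure polynomials

In `ℂ[∂, λ] = ℂ[X][Y]` the variable `∂` is `C X` and the variable `λ` is `Y`. -/

/-- The variable `∂` of `ℂ[∂, λ]`. -/
abbrev del : ℂ[X][Y] := C X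

/-- The variable `λ` of `ℂ[∂, λ]`. -/
abbrev lam : ℂ[X][Y] := Polynomial.X

/-- `f(s, t)` for `f(∂, λ)` and `s, t ∈ ℂ[∂]`. -/
def substDL (s t : ℂ[X]) : ℂ[X][Y] →+* ℂ[X] := eval₂RingHom (compRingHom s) t

/-- `f(∂, -∂ - λ)` for `f(∂, λ)`. -/
def skewFlip (f : ℂ[X][Y]) : ℂ[X][Y] := f.comp (-del - lam)

/-- A polynomial is skew-symmetric if `f(x, y) = -f(x, -x - y)`. -/
def IsSkewSymmetric (f : ℂ[X][Y]) : Prop := f = -skewFlip f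

/-- The conditions on `[Eᵢ_λ Eⱼ] = ∑ₖ Qᵢⱼᵏ(∂, λ) Eₖ`, with `Eᵢ` of parity `par i`, to define a Lie
conformal superalgebra on the free module with basis `(Eᵢ)`. -/
structure IsStructure {ι : Type*} [Fintype ι] (par : ι → ZMod 2) (Q : ι → ι → ι → ℂ[X][Y]) :
    Prop where
  graded : ∀ i j k, par k ≠ par i + par j → Q i j k = 0
  skew : ∀ i j k, Q i j k = -(paritySign (par i) (par j) • skewFlip (Q j i k))
  jacobi : ∀ i j k t (z w : ℂ),
    ∑ s, substDL (X + C z) (C w) (Q j k s) * substDL X (C z) (Q i s t) =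
      ∑ s, substDL (-C (z + w)) (C z) (Q i j s) * substDL X (C (z + w)) (Q s k t) +
        paritySign (par i) (par j) •
          ∑ s, substDL (X + C w) (C z) (Q i k s) * substDL X (C w) (Q j s t)

/-- The `k`-th coordinate of `[a_λ b]`: by sesquilinearity
`[f(∂)Eᵢ_λ g(∂)Eⱼ] = f(-λ) g(∂ + λ) [Eᵢ_λ Eⱼ]`. -/
def bracketPoly {ι : Type*} [Fintype ι] (Q : ι → ι → ι → ℂ[X][Y]) (a b : ι → ℂ[X]) (k : ι) :
    ℂ[X][Y] :=
  ∑ i, ∑ j, aeval (-lam) (a i) * aeval (del + lam) (b j) * Q i j k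

/-- The family of coefficients of a vector of polynomials in `λ`. -/
def coeffFamily {ι : Type*} [Fintype ι] (P : ι → ℂ[X][Y]) : ℕ →₀ (ι → ℂ[X]) :=
  Finsupp.onFinset (Finset.univ.biUnion fun k => (P k).support) (fun n k => (P k).coeff n) (by
    intro n hn
    obtain ⟨k, hk⟩ := Function.ne_iff.1 hn
    exact Finset.mem_biUnion.2 ⟨k, Finset.mem_univ k, mem_support_iff.2 hk⟩)

theorem evalLambda_coeffFamily {ι : Type*} [Fintype ι] (P : ι → ℂ[X][Y]) (t : ℂ[X]) (k : ι) :
    evalLambda t (coeffFamily P) k = substDL X t (P k) := by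
  have h1 : substDL X t (P k) = (P k).eval t := by
    simp only [substDL, coe_eval₂RingHom, eval, eval₂_eq_sum]
    simp [Polynomial.sum]
  rw [h1, eval_eq_sum, Polynomial.sum, evalLambda, coeffFamily, Finsupp.onFinset_sum _ (by simp),
    Finset.sum_apply]
  symm
  refine Finset.sum_subset_zero_on_sdiff ?_ ?_ ?_
  · intro n hn
    exact Finset.mem_biUnion.2 ⟨k, Finset.mem_univ k, hn⟩
  · intro n hn
    have : (P k).coeff n = 0 := by simpa using (Finset.mem_sdiff.1 hn).2
    simp [this]
  · intro n _
    simp [mul_comm]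

theorem subst_neg_Y (s t f : ℂ[X]) : substDL s t (aeval (-lam) f) = f.comp (-t) := by
  induction f using Polynomial.induction_on' with
  | add p q hp hq => simp [hp, hq]
  | monomial n c =>
    rw [aeval_monomial, map_mul, map_pow, IsScalarTower.algebraMap_apply ℂ ℂ[X] ℂ[X][Y],
      ← C_mul_X_pow_eq_monomial]
    simp [substDL]

theorem subst_add_Y (s t f : ℂ[X]) :
    substDL s t (aeval (del + lam) f) = f.comp (s + t) := by
  induction f using Polynomial.induction_on' with
  | add p q hp hq => simp [hp, hq]
  | monomial n c =>
    rw [aeval_monomial, map_mul, map_pow, IsScalarTower.algebraMap_apply ℂ ℂ[X] ℂ[X][Y],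
      ← C_mul_X_pow_eq_monomial]
    simp [substDL]

theorem subst_comp (s t u : ℂ[X]) (f : ℂ[X][Y]) :
    (substDL s t f).comp u = substDL (s.comp u) (t.comp u) f := by
  have : (compRingHom u).comp (substDL s t) = substDL (s.comp u) (t.comp u) := by
    apply Polynomial.ringHom_ext
    · intro a; simp [substDL, comp_assoc]
    · simp [substDL]
  exact RingHom.congr_fun this f

theorem subst_skewFlip (s t : ℂ[X]) (f : ℂ[X][Y]) :
    substDL s t (skewFlip f) = substDL s (-s - t) f := by
  have : (substDL s t).comp (compRingHom (-del - lam)) = substDL s (-s - t) := by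
    apply Polynomial.ringHom_ext
    · intro a; simp [substDL]
    · simp [substDL]
  exact RingHom.congr_fun this f

theorem subst_smul (s t : ℂ[X]) (c : ℂ) (f : ℂ[X][Y]) : substDL s t (c • f) = c • substDL s t f := by
  have h : ∀ g : ℂ[X][Y], c • g = C (C c) * g := by
    intro g
    rw [← smul_eq_C_mul, ← algebraMap_smul ℂ[X] c g]; rfl
  rw [h, map_mul, smul_eq_C_mul]
  simp [substDL]

theorem subst_bracketPoly {ι : Type*} [Fintype ι] (Q : ι → ι → ι → ℂ[X][Y]) (a b : ι → ℂ[X])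
    (k : ι) (s t : ℂ[X]) : substDL s t (bracketPoly Q a b k) =
      ∑ i, ∑ j, (a i).comp (-t) * (b j).comp (s + t) * substDL s t (Q i j k) := by
  simp [bracketPoly, subst_neg_Y, subst_add_Y]

/-- The bracket with given structure polynomials. -/
def structureBracket {ι : Type*} [Fintype ι] (Q : ι → ι → ι → ℂ[X][Y]) :
    (ι → ℂ[X]) →ₗ[ℂ] (ι → ℂ[X]) →ₗ[ℂ] (ℕ →₀ (ι → ℂ[X])) :=
  LinearMap.mk₂ ℂ (fun a b => coeffFamily (bracketPoly Q a b))
    (by intros; ext n k : 2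
        simp [coeffFamily, bracketPoly, add_mul, Finset.sum_add_distrib])
    (by intros; ext n k : 2
        simp [coeffFamily, bracketPoly, Finset.smul_sum])
    (by intros; ext n k : 2
        simp [coeffFamily, bracketPoly, add_mul, mul_add, Finset.sum_add_distrib])
    (by intros; ext n k : 2
        simp [coeffFamily, bracketPoly, Finset.smul_sum])

theorem evalLambda_structureBracket {ι : Type*} [Fintype ι] (Q : ι → ι → ι → ℂ[X][Y])
    (a b : ι → ℂ[X]) (t : ℂ[X]) (k : ι) : evalLambda t (structureBracket Q a b) k =
      ∑ i, ∑ j, (a i).comp (-t) * (b j).comp (X + t) * substDL X t (Q i j k) := by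
  change evalLambda t (coeffFamily (bracketPoly Q a b)) k = _
  rw [evalLambda_coeffFamily, subst_bracketPoly]

/-- The vectors supported on the basis elements of parity `p`. -/
def structureGrade {ι : Type*} (par : ι → ZMod 2) (p : ZMod 2) : Submodule ℂ[X] (ι → ℂ[X]) where
  carrier := {v | ∀ i, par i ≠ p → v i = 0}
  zero_mem' := fun _ _ => rfl
  add_mem' := fun ha hb i hi => by simp [ha i hi, hb i hi]
  smul_mem' := fun c a ha i hi => by simp [ha i hi]

theorem structureGrade_isInternal {ι : Type*} (par : ι → ZMod 2) :
    DirectSum.IsInternal (structureGrade par) := by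
  rw [DirectSum.isInternal_submodule_iff_isCompl (structureGrade par) (i := 0) (j := 1)
      (by decide) zmod_two_univ]
  have h01 : ∀ p : ZMod 2, p ≠ 1 → p = 0 := by decide
  constructor
  · rw [Submodule.disjoint_def]
    intro v h0 h1
    ext1 i
    by_cases h : par i = 0
    · exact h1 i (by rw [h]; decide)
    · exact h0 i h
  · rw [codisjoint_iff, eq_top_iff]
    intro v _
    refine Submodule.mem_sup.2 ⟨fun i => if par i = 0 then v i else 0, ?_,
      fun i => if par i = 0 then 0 else v i, ?_, ?_⟩
    · intro i hi; simp [hi]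
    · intro i hi; simp [h01 _ hi]
    · ext1 i; by_cases h : par i = 0 <;> simp [h]

/-- The Lie conformal superalgebra `⨁ᵢ ℂ[∂]Eᵢ` with `[Eᵢ_λ Eⱼ] = ∑ₖ Qᵢⱼᵏ(∂, λ) Eₖ`. -/
def LieConformalSuperalgebra.ofStructure {ι : Type*} [Fintype ι] {par : ι → ZMod 2}
    {Q : ι → ι → ι → ℂ[X][Y]} (h : IsStructure par Q) : LieConformalSuperalgebra (ι → ℂ[X]) where
  grade := structureGrade par
  isInternal := structureGrade_isInternal par
  bracket := structureBracket Q
  bracket_mem := by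
    intro p q a ha b hb n k hk
    change (bracketPoly Q a b k).coeff n = 0
    have : bracketPoly Q a b k = 0 := by
      refine Finset.sum_eq_zero fun i _ => Finset.sum_eq_zero fun j _ => ?_
      by_cases hi : par i = p
      · by_cases hj : par j = q
        · rw [h.graded i j k (by rwa [hi, hj]), mul_zero]
        · rw [hb j hj]; simp
      · rw [ha i hi]; simp
    rw [this, coeff_zero]
  sesqui_left := by
    intro a b z
    ext1 k
    simp only [Pi.neg_apply, Pi.smul_apply, evalLambda_structureBracket, smul_eq_mul, mul_comp,
      X_comp, Finset.mul_sum, ← Finset.sum_neg_distrib]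
    refine Finset.sum_congr rfl fun i _ => Finset.sum_congr rfl fun j _ => ?_
    ring
  sesqui_right := by
    intro a b z
    ext1 k
    simp only [Pi.smul_apply, evalLambda_structureBracket, smul_eq_mul, mul_comp,
      X_comp, Finset.mul_sum]
    refine Finset.sum_congr rfl fun i _ => Finset.sum_congr rfl fun j _ => ?_
    ring
  skew := by
    intro p q a ha b hb z
    ext1 k
    simp only [Pi.neg_apply, Pi.smul_apply, evalLambda_structureBracket, Finset.smul_sum,
      ← Finset.sum_neg_distrib]
    rw [Finset.sum_comm]
    refine Finset.sum_congr rfl fun j _ => Finset.sum_congr rfl fun i _ => ?_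
    by_cases hi : par i = p
    · by_cases hj : par j = q
      · rw [h.skew i j k, hi, hj, map_neg, subst_smul, subst_skewFlip]
        rw [show -(-C z - X : ℂ[X]) = X + C z by ring, show X + (-C z - X) = (-C z : ℂ[X]) by ring,
          show (-X - C z : ℂ[X]) = -C z - X by ring]
        simp only [smul_eq_C_mul]
        ring
      · rw [hb j hj]; simp
    · rw [ha i hi]; simp
  jacobi := by
    intro p q a ha b hb c z w
    ext1 t
    simp only [Pi.add_apply, Pi.smul_apply, evalLambda_structureBracket]
    have hE : ∀ (a b : ι → ℂ[X]) (x : ℂ) (u : ℂ[X]) (s : ι),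
        (evalLambda (C x) (structureBracket Q a b) s).comp u =
          ∑ i, ∑ j, (a i).comp (-C x) * (b j).comp (u + C x) * substDL u (C x) (Q i j s) := by
      intro a b x u s
      simp [evalLambda_structureBracket, subst_comp, comp_assoc, Polynomial.sum_comp]
    simp only [← evalLambda_structureBracket, hE]
    have e1 : (X + C z + C w : ℂ[X]) = X + C (z + w) := by rw [C_add]; ring
    have e2 : (X + C w + C z : ℂ[X]) = X + C (z + w) := by rw [C_add]; ring
    have e3 : (-C (z + w) + C z : ℂ[X]) = -C w := by rw [C_add]; ring
    rw [e1, e2, e3]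
    have L : ∑ i, ∑ s, (a i).comp (-C z) *
          (∑ j, ∑ k, (b j).comp (-C w) * (c k).comp (X + C (z + w)) *
            substDL (X + C z) (C w) (Q j k s)) * substDL X (C z) (Q i s t) =
        ∑ i, ∑ j, ∑ k, (a i).comp (-C z) * (b j).comp (-C w) * (c k).comp (X + C (z + w)) *
          ∑ s, substDL (X + C z) (C w) (Q j k s) * substDL X (C z) (Q i s t) := by
      refine Finset.sum_congr rfl fun i _ => ?_
      simp only [Finset.mul_sum, Finset.sum_mul]
      rw [Finset.sum_comm]
      refine Finset.sum_congr rfl fun j _ => ?_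
      rw [Finset.sum_comm]
      refine Finset.sum_congr rfl fun k _ => Finset.sum_congr rfl fun s _ => ?_
      ring
    have M : ∑ j, ∑ s, (b j).comp (-C w) *
          (∑ i, ∑ k, (a i).comp (-C z) * (c k).comp (X + C (z + w)) *
            substDL (X + C w) (C z) (Q i k s)) * substDL X (C w) (Q j s t) =
        ∑ i, ∑ j, ∑ k, (a i).comp (-C z) * (b j).comp (-C w) * (c k).comp (X + C (z + w)) *
          ∑ s, substDL (X + C w) (C z) (Q i k s) * substDL X (C w) (Q j s t) := by
      rw [Finset.sum_comm (s := Finset.univ) (t := Finset.univ) (f := fun i j => ∑ k,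
        (a i).comp (-C z) * (b j).comp (-C w) * (c k).comp (X + C (z + w)) *
          ∑ s, substDL (X + C w) (C z) (Q i k s) * substDL X (C w) (Q j s t))]
      refine Finset.sum_congr rfl fun j _ => ?_
      simp only [Finset.mul_sum, Finset.sum_mul]
      rw [Finset.sum_comm]
      refine Finset.sum_congr rfl fun i _ => ?_
      rw [Finset.sum_comm]
      refine Finset.sum_congr rfl fun k _ => Finset.sum_congr rfl fun s _ => ?_
      ring
    have N : ∑ s, ∑ k, (∑ i, ∑ j, (a i).comp (-C z) * (b j).comp (-C w) *
            substDL (-C (z + w)) (C z) (Q i j s)) * (c k).comp (X + C (z + w)) *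
            substDL X (C (z + w)) (Q s k t) =
        ∑ i, ∑ j, ∑ k, (a i).comp (-C z) * (b j).comp (-C w) * (c k).comp (X + C (z + w)) *
          ∑ s, substDL (-C (z + w)) (C z) (Q i j s) * substDL X (C (z + w)) (Q s k t) := by
      simp only [Finset.mul_sum, Finset.sum_mul]
      rw [Finset.sum_comm]
      have : ∀ k s, (∑ i, ∑ j, (a i).comp (-C z) * (b j).comp (-C w) *
          substDL (-C (z + w)) (C z) (Q i j s) * (c k).comp (X + C (z + w)) *
            substDL X (C (z + w)) (Q s k t)) = ∑ i, ∑ j, (a i).comp (-C z) * (b j).comp (-C w) *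
            (c k).comp (X + C (z + w)) *
          (substDL (-C (z + w)) (C z) (Q i j s) * substDL X (C (z + w)) (Q s k t)) := by
        intro k s
        refine Finset.sum_congr rfl fun i _ => Finset.sum_congr rfl fun j _ => ?_
        ring
      simp only [this]
      rw [Finset.sum_congr rfl fun k _ => Finset.sum_comm, Finset.sum_comm]
      refine Finset.sum_congr rfl fun i _ => ?_
      rw [Finset.sum_congr rfl fun k _ => Finset.sum_comm, Finset.sum_comm]
    rw [L, M, N]
    simp only [Finset.smul_sum, ← Finset.sum_add_distrib]
    refine Finset.sum_congr rfl fun i _ => Finset.sum_congr rfl fun j _ =>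
      Finset.sum_congr rfl fun k _ => ?_
    by_cases hi : par i = p
    · by_cases hj : par j = q
      · rw [h.jacobi i j k t z w, hi, hj]
        simp only [smul_eq_C_mul, mul_add, Finset.mul_sum]
        congr 1
        refine Finset.sum_congr rfl fun s _ => ?_
        ring
      · rw [hb j hj]; simp
    · rw [ha i hi]; simp

/-! ### The nontrivial algebras of rank `(2+1)` of types A, B, C

The carrier `Fin 3 → ℂ[X]` is `ℂ[∂]A ⊕ ℂ[∂]B ⊕ ℂ[∂]X` with `A = E₀`, `B = E₁` even and `X = E₂` odd. -/

/-- Coordinates, with respect to `A`, `B`, `X`, of the brackets `[A_λ A]`, `[A_λ B]`, `[B_λ B]`,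
`[A_λ X]`, `[B_λ X]`, `[X_λ X]`; those not mentioned vanish. -/
structure Relations where
  AA : Fin 3 → ℂ[X][Y] := 0
  AB : Fin 3 → ℂ[X][Y] := 0
  BB : Fin 3 → ℂ[X][Y] := 0
  AX : Fin 3 → ℂ[X][Y] := 0
  BX : Fin 3 → ℂ[X][Y] := 0
  XX : Fin 3 → ℂ[X][Y] := 0

/-- All structure polynomials; `[B_λ A]`, `[X_λ A]`, `[X_λ B]` are given by skew-symmetry. -/
def Relations.toConstants (r : Relations) : Fin 3 → Fin 3 → Fin 3 → ℂ[X][Y] :=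
  ![![r.AA, r.AB, r.AX],
    ![fun k => -skewFlip (r.AB k), r.BB, r.BX],
    ![fun k => -skewFlip (r.AX k), fun k => -skewFlip (r.BX k), r.XX]]

theorem Relations.toConstants_entries (r : Relations) :
    r.toConstants 0 0 = r.AA ∧ r.toConstants 0 1 = r.AB ∧ r.toConstants 0 2 = r.AX ∧
    r.toConstants 1 0 = (fun k => -skewFlip (r.AB k)) ∧ r.toConstants 1 1 = r.BB ∧
    r.toConstants 1 2 = r.BX ∧ r.toConstants 2 0 = (fun k => -skewFlip (r.AX k)) ∧
    r.toConstants 2 1 = (fun k => -skewFlip (r.BX k)) ∧ r.toConstants 2 2 = r.XX :=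
  ⟨rfl, rfl, rfl, rfl, rfl, rfl, rfl, rfl, rfl⟩

/-- The parities of `A`, `B`, `X`. -/
def parityABX : Fin 3 → ZMod 2 := ![0, 0, 1]

theorem parityABX_entries : parityABX 0 = 0 ∧ parityABX 1 = 0 ∧ parityABX 2 = 1 :=
  ⟨rfl, rfl, rfl⟩

/-- `φ(λ)` as an element of `ℂ[∂, λ]`. -/
def inLam (φ : ℂ[X]) : ℂ[X][Y] := φ.map C

/-- `ψ(∂)` as an element of `ℂ[∂, λ]`. -/
def inDel (ψ : ℂ[X]) : ℂ[X][Y] := C ψ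

/-- The constant `α` as an element of `ℂ[∂, λ]`. -/
def cst (α : ℂ) : ℂ[X][Y] := C (C α)

theorem subst_del (s t : ℂ[X]) : substDL s t del = s := by simp [substDL]

theorem subst_lam (s t : ℂ[X]) : substDL s t lam = t := by simp [substDL]

theorem subst_inLam (s t φ : ℂ[X]) : substDL s t (inLam φ) = φ.comp t := by
  simp only [substDL, inLam, coe_eval₂RingHom, eval₂_map, comp]
  congr 1
  ext c
  simp

theorem subst_inDel (s t ψ : ℂ[X]) : substDL s t (inDel ψ) = ψ.comp s := by
  simp [substDL, inDel]

theorem subst_two (s t : ℂ[X]) : substDL s t 2 = 2 := map_ofNat _ 2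

theorem subst_cst (s t : ℂ[X]) (α : ℂ) : substDL s t (cst α) = C α := by
  simp [substDL, cst]

theorem skewFlip_zero : skewFlip 0 = 0 := by simp [skewFlip]

theorem skewFlip_skewFlip (f : ℂ[X][Y]) : skewFlip (skewFlip f) = f := by
  simp [skewFlip, comp_assoc]

theorem skewFlip_vir : skewFlip (del + 2 * lam) = -(del + 2 * lam) := by
  simp [skewFlip]; ring

theorem skewFlip_inDel (ψ : ℂ[X]) : skewFlip (inDel ψ) = inDel ψ := by
  simp [skewFlip, inDel]

theorem skewFlip_two : skewFlip 2 = 2 := by simp [skewFlip]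

/-- `𝒜₁`: `[A_λ A] = f(∂, λ) B`, `[A_λ X] = φ(λ) X`. -/
def relA1 (f : ℂ[X][Y]) (φ : ℂ[X]) : Relations where
  AA := ![0, f, 0]
  AX := ![0, 0, inLam φ]

/-- `𝒜₂`: `[A_λ A] = f(∂, λ) B`, `[X_λ X] = ψ(∂) B`. -/
def relA2 (f : ℂ[X][Y]) (ψ : ℂ[X]) : Relations where
  AA := ![0, f, 0]
  XX := ![0, inDel ψ, 0]

/-- `𝒜₃`: `[A_λ B] = 2φ(λ) B`, `[A_λ X] = φ(λ) X`, `[X_λ X] = 2B`. -/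
def relA3 (φ : ℂ[X]) : Relations where
  AB := ![0, 2 * inLam φ, 0]
  AX := ![0, 0, inLam φ]
  XX := ![0, 2, 0]

/-- `𝒜₄`: `[A_λ B] = p(λ) B`, `[A_λ X] = φ(λ) X`. -/
def relA4 (p φ : ℂ[X]) : Relations where
  AB := ![0, inLam p, 0]
  AX := ![0, 0, inLam φ]

/-- `ℬ₁`: `[A_λ A] = (∂ + 2λ) A`, `[B_λ B] = (∂ + 2λ) B`, `[A_λ X] = (∂ + αλ + β) X`. -/
def relB1 (α β : ℂ) : Relations where
  AA := ![del + 2 * lam, 0, 0]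
  BB := ![0, del + 2 * lam, 0]
  AX := ![0, 0, del + cst α * lam + cst β]

/-- `ℬ₂`: `[A_λ A] = (∂ + 2λ) A`, `[B_λ B] = (∂ + 2λ) B`, `[A_λ X] = (∂ + 3/2 λ) X`,
`[X_λ X] = 2A`. -/
def relB2 : Relations where
  AA := ![del + 2 * lam, 0, 0]
  BB := ![0, del + 2 * lam, 0]
  AX := ![0, 0, del + cst (3 / 2) * lam]
  XX := ![2, 0, 0]

/-- `𝒞₁`: `[A_λ A] = (∂ + 2λ) A`, `[A_λ X] = (∂ + αλ + β) X`. -/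
def relC1 (α β : ℂ) : Relations where
  AA := ![del + 2 * lam, 0, 0]
  AX := ![0, 0, del + cst α * lam + cst β]

/-- `𝒞₂`: `[A_λ A] = (∂ + 2λ) A`, `[A_λ X] = (∂ + 3/2 λ) X`, `[X_λ X] = 2A`. -/
def relC2 : Relations where
  AA := ![del + 2 * lam, 0, 0]
  AX := ![0, 0, del + cst (3 / 2) * lam]
  XX := ![2, 0, 0]

/-- `𝒞₃`: `[A_λ A] = (∂ + 2λ) A`, `[B_λ X] = φ(λ) X`. -/
def relC3 (φ : ℂ[X]) : Relations where
  AA := ![del + 2 * lam, 0, 0]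
  BX := ![0, 0, inLam φ]

/-- A grading and skew-symmetry check for all relations of the above shape. -/
theorem Relations.isStructure (r : Relations)
    (hAA : r.AA 2 = 0 ∧ r.AB 2 = 0 ∧ r.BB 2 = 0 ∧ r.XX 2 = 0)
    (hAX : r.AX 0 = 0 ∧ r.AX 1 = 0 ∧ r.BX 0 = 0 ∧ r.BX 1 = 0)
    (hs : ∀ k, r.AA k = -skewFlip (r.AA k) ∧ r.BB k = -skewFlip (r.BB k) ∧
      r.XX k = skewFlip (r.XX k))
    (hj : ∀ i j k t (z w : ℂ),
      ∑ s, substDL (X + C z) (C w) (r.toConstants j k s) * substDL X (C z) (r.toConstants i s t) =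
      ∑ s, substDL (-C (z + w)) (C z) (r.toConstants i j s) *
          substDL X (C (z + w)) (r.toConstants s k t) +
        paritySign (parityABX i) (parityABX j) •
          ∑ s, substDL (X + C w) (C z) (r.toConstants i k s) *
            substDL X (C w) (r.toConstants j s t)) :
    IsStructure parityABX r.toConstants where
  graded := by
    obtain ⟨h1, h2, h3, h4⟩ := hAA
    obtain ⟨h5, h6, h7, h8⟩ := hAX
    intro i j k h
    fin_cases i <;> fin_cases j <;> fin_cases k <;>
      first
      | (exact absurd (by decide) h)
      | simp [Relations.toConstants, h1, h2, h3, h4, h5, h6, h7, h8, skewFlip_zero]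
  skew := by
    have hneg : ∀ f : ℂ[X][Y], skewFlip (-f) = -skewFlip f := fun f => by simp [skewFlip]
    intro i j k
    obtain ⟨h1, h2, h3⟩ := hs k
    fin_cases i <;> fin_cases j <;>
      simp [Relations.toConstants, parityABX, paritySign_00, paritySign_01, paritySign_10,
        paritySign_11, hneg, skewFlip_skewFlip] <;>
      assumption
  jacobi := hj

theorem isStructure_A1 (f : ℂ[X][Y]) (hf : IsSkewSymmetric f) (φ : ℂ[X]) : IsStructure parityABX (relA1 f φ).toConstants := by
  apply Relations.isStructure
  · simp [relA1]
  · simp [relA1]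
  · intro k
    fin_cases k <;> simp [relA1, skewFlip_zero]; exact hf
  · simp only [Fin.forall_fin_succ, IsEmpty.forall_iff, and_true, Fin.sum_univ_three, Fin.isValue,
      Fin.succ_zero_eq_one, Fin.succ_one_eq_two, Relations.toConstants_entries, relA1,
      Matrix.cons_val, Pi.zero_apply, map_zero, mul_zero, zero_mul, add_zero, zero_add, smul_zero,
      map_neg, skewFlip_zero, neg_zero, true_and, parityABX_entries, paritySign_00, paritySign_01,
      paritySign_10, paritySign_11, one_smul, implies_true, and_self]
    repeat' apply And.intro
    all_goals
      intro z w
      apply Polynomial.funext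
      intro x
      simp only [subst_skewFlip, subst_inLam, map_add, map_mul,
        map_neg, neg_smul, one_smul, eval_add, eval_mul, eval_neg, eval_sub, eval_comp, eval_C, eval_X,
        eval_zero, eval_ofNat]
      ring_nf

theorem isStructure_A2 (f : ℂ[X][Y]) (hf : IsSkewSymmetric f) (ψ : ℂ[X]) : IsStructure parityABX (relA2 f ψ).toConstants := by
  apply Relations.isStructure
  · simp [relA2]
  · simp [relA2]
  · intro k
    fin_cases k <;> simp [relA2, skewFlip_zero, skewFlip_inDel]; exact hf
  · simp only [Fin.forall_fin_succ, IsEmpty.forall_iff, and_true, Fin.sum_univ_three, Fin.isValue,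
      Fin.succ_zero_eq_one, Fin.succ_one_eq_two, Relations.toConstants_entries, relA2,
      Matrix.cons_val, Pi.zero_apply, map_zero, mul_zero, zero_mul, add_zero, zero_add, smul_zero,
      map_neg, skewFlip_zero, neg_zero, true_and, parityABX_entries, paritySign_00, paritySign_01,
      paritySign_10, paritySign_11, one_smul, implies_true, and_self]

theorem isStructure_A3 (φ : ℂ[X]) : IsStructure parityABX (relA3 φ).toConstants := by
  apply Relations.isStructure
  · simp [relA3]
  · simp [relA3]
  · intro k
    fin_cases k <;> simp [relA3, skewFlip_zero, skewFlip_two]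
  · simp only [Fin.forall_fin_succ, IsEmpty.forall_iff, and_true, Fin.sum_univ_three, Fin.isValue,
      Fin.succ_zero_eq_one, Fin.succ_one_eq_two, Relations.toConstants_entries, relA3,
      Matrix.cons_val, Pi.zero_apply, map_zero, mul_zero, zero_mul, add_zero, zero_add, smul_zero,
      map_neg, skewFlip_zero, neg_zero, true_and, parityABX_entries, paritySign_00, paritySign_01,
      paritySign_10, paritySign_11, one_smul, implies_true, and_self]
    repeat' apply And.intro
    all_goals
      intro z w
      apply Polynomial.funext
      intro x
      simp only [subst_skewFlip, subst_inLam, subst_two, map_add, map_mul,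
        map_neg, neg_smul, one_smul, eval_add, eval_mul, eval_neg, eval_sub, eval_comp, eval_C, eval_X,
        eval_zero, eval_ofNat]
      ring_nf

theorem isStructure_A4 (p φ : ℂ[X]) : IsStructure parityABX (relA4 p φ).toConstants := by
  apply Relations.isStructure
  · simp [relA4]
  · simp [relA4]
  · intro k
    fin_cases k <;> simp [relA4, skewFlip_zero]
  · simp only [Fin.forall_fin_succ, IsEmpty.forall_iff, and_true, Fin.sum_univ_three, Fin.isValue,
      Fin.succ_zero_eq_one, Fin.succ_one_eq_two, Relations.toConstants_entries, relA4,
      Matrix.cons_val, Pi.zero_apply, map_zero, mul_zero, zero_mul, add_zero, zero_add, smul_zero,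
      map_neg, skewFlip_zero, neg_zero, true_and, parityABX_entries, paritySign_00, paritySign_01,
      paritySign_10, paritySign_11, one_smul, implies_true, and_self]
    repeat' apply And.intro
    all_goals
      intro z w
      apply Polynomial.funext
      intro x
      simp only [subst_skewFlip, subst_inLam, map_add, map_mul,
        map_neg, neg_smul, one_smul, eval_add, eval_mul, eval_neg, eval_sub, eval_comp, eval_C, eval_X,
        eval_zero, eval_ofNat]
      ring_nf

theorem isStructure_B1 (α β : ℂ) : IsStructure parityABX (relB1 α β).toConstants := by
  apply Relations.isStructure
  · simp [relB1]
  · simp [relB1]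
  · intro k
    fin_cases k <;> simp [relB1, skewFlip_zero, skewFlip_vir]
  · simp only [Fin.forall_fin_succ, IsEmpty.forall_iff, and_true, Fin.sum_univ_three, Fin.isValue,
      Fin.succ_zero_eq_one, Fin.succ_one_eq_two, Relations.toConstants_entries, relB1,
      Matrix.cons_val, Pi.zero_apply, map_zero, mul_zero, zero_mul, add_zero, zero_add, smul_zero,
      map_neg, skewFlip_zero, neg_zero, true_and, parityABX_entries, paritySign_00, paritySign_01,
      paritySign_10, paritySign_11, one_smul, implies_true, and_self]
    repeat' apply And.intro
    all_goals
      intro z w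
      apply Polynomial.funext
      intro x
      simp only [subst_skewFlip, subst_del, subst_lam, subst_cst, subst_two, map_add, map_mul,
        map_neg, neg_smul, one_smul, eval_add, eval_mul, eval_neg, eval_sub, eval_comp, eval_C, eval_X,
        eval_zero, eval_ofNat]
      ring_nf

theorem isStructure_B2 : IsStructure parityABX relB2.toConstants := by
  apply Relations.isStructure
  · simp [relB2]
  · simp [relB2]
  · intro k
    fin_cases k <;> simp [relB2, skewFlip_zero, skewFlip_two, skewFlip_vir]
  · simp only [Fin.forall_fin_succ, IsEmpty.forall_iff, and_true, Fin.sum_univ_three, Fin.isValue,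
      Fin.succ_zero_eq_one, Fin.succ_one_eq_two, Relations.toConstants_entries, relB2,
      Matrix.cons_val, Pi.zero_apply, map_zero, mul_zero, zero_mul, add_zero, zero_add, smul_zero,
      map_neg, skewFlip_zero, neg_zero, true_and, parityABX_entries, paritySign_00, paritySign_01,
      paritySign_10, paritySign_11, one_smul, implies_true, and_self]
    repeat' apply And.intro
    all_goals
      intro z w
      apply Polynomial.funext
      intro x
      simp only [subst_skewFlip, subst_del, subst_lam, subst_cst, subst_two, map_add, map_mul,
        map_neg, neg_smul, one_smul, eval_add, eval_mul, eval_neg, eval_sub, eval_comp, eval_C, eval_X,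
        eval_zero, eval_ofNat]
      ring_nf

theorem isStructure_C1 (α β : ℂ) : IsStructure parityABX (relC1 α β).toConstants := by
  apply Relations.isStructure
  · simp [relC1]
  · simp [relC1]
  · intro k
    fin_cases k <;> simp [relC1, skewFlip_zero, skewFlip_vir]
  · simp only [Fin.forall_fin_succ, IsEmpty.forall_iff, and_true, Fin.sum_univ_three, Fin.isValue,
      Fin.succ_zero_eq_one, Fin.succ_one_eq_two, Relations.toConstants_entries, relC1,
      Matrix.cons_val, Pi.zero_apply, map_zero, mul_zero, zero_mul, add_zero, zero_add, smul_zero,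
      map_neg, skewFlip_zero, neg_zero, true_and, parityABX_entries, paritySign_00, paritySign_01,
      paritySign_10, paritySign_11, one_smul, implies_true, and_self]
    repeat' apply And.intro
    all_goals
      intro z w
      apply Polynomial.funext
      intro x
      simp only [subst_skewFlip, subst_del, subst_lam, subst_cst, subst_two, map_add, map_mul,
        map_neg, neg_smul, one_smul, eval_add, eval_mul, eval_neg, eval_sub, eval_comp, eval_C, eval_X,
        eval_zero, eval_ofNat]
      ring_nf

theorem isStructure_C2 : IsStructure parityABX relC2.toConstants := by
  apply Relations.isStructure
  · simp [relC2]
  · simp [relC2]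
  · intro k
    fin_cases k <;> simp [relC2, skewFlip_zero, skewFlip_two, skewFlip_vir]
  · simp only [Fin.forall_fin_succ, IsEmpty.forall_iff, and_true, Fin.sum_univ_three, Fin.isValue,
      Fin.succ_zero_eq_one, Fin.succ_one_eq_two, Relations.toConstants_entries, relC2,
      Matrix.cons_val, Pi.zero_apply, map_zero, mul_zero, zero_mul, add_zero, zero_add, smul_zero,
      map_neg, skewFlip_zero, neg_zero, true_and, parityABX_entries, paritySign_00, paritySign_01,
      paritySign_10, paritySign_11, one_smul, implies_true, and_self]
    repeat' apply And.intro
    all_goals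
      intro z w
      apply Polynomial.funext
      intro x
      simp only [subst_skewFlip, subst_del, subst_lam, subst_cst, subst_two, map_add, map_mul,
        map_neg, neg_smul, one_smul, eval_add, eval_mul, eval_neg, eval_sub, eval_comp, eval_C, eval_X,
        eval_zero, eval_ofNat]
      ring_nf

theorem isStructure_C3 (φ : ℂ[X]) : IsStructure parityABX (relC3 φ).toConstants := by
  apply Relations.isStructure
  · simp [relC3]
  · simp [relC3]
  · intro k
    fin_cases k <;> simp [relC3, skewFlip_zero, skewFlip_vir]
  · simp only [Fin.forall_fin_succ, IsEmpty.forall_iff, and_true, Fin.sum_univ_three, Fin.isValue,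
      Fin.succ_zero_eq_one, Fin.succ_one_eq_two, Relations.toConstants_entries, relC3,
      Matrix.cons_val, Pi.zero_apply, map_zero, mul_zero, zero_mul, add_zero, zero_add, smul_zero,
      map_neg, skewFlip_zero, neg_zero, true_and, parityABX_entries, paritySign_00, paritySign_01,
      paritySign_10, paritySign_11, one_smul, implies_true, and_self]
    repeat' apply And.intro
    all_goals
      intro z w
      apply Polynomial.funext
      intro x
      simp only [subst_skewFlip, subst_inLam, subst_del, subst_lam, subst_two, map_add, map_mul,
        map_neg, neg_smul, one_smul, eval_add, eval_mul, eval_neg, eval_sub, eval_comp, eval_C, eval_X,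
        eval_zero, eval_ofNat]
      ring_nf

/-- The Lie conformal superalgebra `𝒜₁`. -/
def algA1 (f : ℂ[X][Y]) (hf : IsSkewSymmetric f) (φ : ℂ[X]) : LieConformalSuperalgebra (Fin 3 → ℂ[X]) :=
  .ofStructure (isStructure_A1 f hf φ)

/-- The Lie conformal superalgebra `𝒜₂`. -/
def algA2 (f : ℂ[X][Y]) (hf : IsSkewSymmetric f) (ψ : ℂ[X]) : LieConformalSuperalgebra (Fin 3 → ℂ[X]) :=
  .ofStructure (isStructure_A2 f hf ψ)

/-- The Lie conformal superalgebra `𝒜₃`. -/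
def algA3 (φ : ℂ[X]) : LieConformalSuperalgebra (Fin 3 → ℂ[X]) :=
  .ofStructure (isStructure_A3 φ)

/-- The Lie conformal superalgebra `𝒜₄`. -/
def algA4 (p φ : ℂ[X]) : LieConformalSuperalgebra (Fin 3 → ℂ[X]) :=
  .ofStructure (isStructure_A4 p φ)

/-- The Lie conformal superalgebra `ℬ₁`. -/
def algB1 (α β : ℂ) : LieConformalSuperalgebra (Fin 3 → ℂ[X]) :=
  .ofStructure (isStructure_B1 α β)

/-- The Lie conformal superalgebra `ℬ₂`. -/
def algB2 : LieConformalSuperalgebra (Fin 3 → ℂ[X]) :=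
  .ofStructure (isStructure_B2)

/-- The Lie conformal superalgebra `𝒞₁`. -/
def algC1 (α β : ℂ) : LieConformalSuperalgebra (Fin 3 → ℂ[X]) :=
  .ofStructure (isStructure_C1 α β)

/-- The Lie conformal superalgebra `𝒞₂`. -/
def algC2 : LieConformalSuperalgebra (Fin 3 → ℂ[X]) :=
  .ofStructure (isStructure_C2)

/-- The Lie conformal superalgebra `𝒞₃`. -/
def algC3 (φ : ℂ[X]) : LieConformalSuperalgebra (Fin 3 → ℂ[X]) :=
  .ofStructure (isStructure_C3 φ)

/-! ### The groups -/

/-- `ℂˣ` acting on the additive group of a complex vector space by scalar multiplication. -/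
def scalarAction (V : Type*) [AddCommGroup V] [Module ℂ V] : ℂˣ →* MulAut (Multiplicative V) :=
  (MulAutMultiplicative V).symm.toMonoidHom.comp (DistribMulAction.toAddAut ℂˣ V)

/-- `ℂˣ` acting on the additive group of `ℂ` by `t · z = t² z`. -/
def squareAction : ℂˣ →* MulAut (Multiplicative ℂ) :=
  (scalarAction ℂ).comp (powMonoidHom 2)

end

/-! ### Automorphisms in terms of generators -/

/-! An automorphism is `ℂ[∂]`-linear, so it is determined by the images of `A`, `B`, `X`.
Sesquilinearity reduces bracket preservation to pairs of generators (`map_structureBracket_iff`),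
and skew-symmetry leaves six pairs. Parity makes the matrix block diagonal: `A ↦ aA + bB`, `B ↦ cA +
dB`, `X ↦ eX`, where `ad - bc` and `e` are units of `ℂ[∂]`, that is, nonzero constants.

In each algebra one of the six relations forces `c = 0`. Then `ad` is a unit, so `a`, `d`, `e` are
nonzero constants and only `b` may be a genuine polynomial (`mem_Aut_iff_triangular`). The other
relations are identities in the domain `ℂ[∂, λ]`; cancelling nonzero structure polynomials turns
them into equations such as `a = 1`, `d = a²`, `e² = 1`. For `𝒜₁` and `𝒜₂` the polynomial `b` is
free, because `B` is central. For `𝒜₃` and `𝒜₄` the relation `[A_λ A] = 0` confines `b` to the line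
spanned by `φ(-∂)`, respectively `p(-∂)` (`symm_relation_iff`). In types `ℬ` and `𝒞` it vanishes.

The group law is read off from `triangular_mul`: the new off-diagonal entry is `b a' + d b'`. For
each algebra a homomorphism from the claimed group into the linear automorphisms is written down,
injective and with image exactly `Aut` (`nonempty_mulEquiv_of_range`). -/

theorem aeval_del_add_lam_C (c : ℂ) : aeval (del + lam) (C c : ℂ[X]) = (C (C c) : ℂ[X][Y]) := by
  simp [aeval_C, IsScalarTower.algebraMap_apply ℂ ℂ[X] ℂ[X][Y]]

theorem aeval_neg_lam_C (c : ℂ) : aeval (-lam) (C c : ℂ[X]) = (C (C c) : ℂ[X][Y]) := by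
  simp [aeval_C, IsScalarTower.algebraMap_apply ℂ ℂ[X] ℂ[X][Y]]

theorem skewFlip_aeval (t : ℂ[X][Y]) (f : ℂ[X]) :
    skewFlip (aeval t f) = aeval (skewFlip t) f := by
  have h : ((compRingHom (-del - lam)).comp (aeval t : ℂ[X] →ₐ[ℂ] ℂ[X][Y]).toRingHom) =
      (aeval (skewFlip t) : ℂ[X] →ₐ[ℂ] ℂ[X][Y]).toRingHom := by
    apply Polynomial.ringHom_ext
    · intro a
      simp [IsScalarTower.algebraMap_apply ℂ ℂ[X] ℂ[X][Y]]
    · simp [skewFlip]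
  exact RingHom.congr_fun h f

theorem skewFlip_mul (f g : ℂ[X][Y]) : skewFlip (f * g) = skewFlip f * skewFlip g := by
  simp [skewFlip]

theorem skewFlip_sum {ι : Type*} (s : Finset ι) (f : ι → ℂ[X][Y]) :
    skewFlip (∑ i ∈ s, f i) = ∑ i ∈ s, skewFlip (f i) :=
  map_sum (compRingHom (-del - lam)) f s

theorem skewFlip_C (f : ℂ[X]) : skewFlip (C f) = C f := by
  simp [skewFlip]

theorem smul_eq_C_C_mul (c : ℂ) (f : ℂ[X][Y]) : c • f = C (C c) * f := by
  rw [← smul_eq_C_mul, ← algebraMap_smul ℂ[X] c f]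
  rfl

theorem skewFlip_neg_lam : skewFlip (-lam) = del + lam := by
  simp [skewFlip, add_comm]

theorem skewFlip_del_add_lam : skewFlip (del + lam) = -lam := by
  simp only [skewFlip, add_comp, C_comp, X_comp]
  ring

/-! ### Sesquilinear extension from generators to the free module. -/

section Generators

variable {ι : Type*} [Fintype ι] {par : ι → ZMod 2} {Q : ι → ι → ι → ℂ[X][Y]}

/-- The substitution `λ ↦ -∂ - λ` exchanges `-λ` and `∂ + λ`, the arguments at which the left and
right coefficients are evaluated; skew-symmetry therefore passes from generators to all homogeneous
vectors. -/
theorem skewFlip_bracketPoly (h : IsStructure par Q) {p q : ZMod 2} {a b : ι → ℂ[X]}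
    (ha : a ∈ structureGrade par p) (hb : b ∈ structureGrade par q) (k : ι) :
    bracketPoly Q a b k = -(paritySign p q • skewFlip (bracketPoly Q b a k)) := by
  simp only [bracketPoly, skewFlip_sum, skewFlip_mul, skewFlip_aeval, skewFlip_neg_lam,
    skewFlip_del_add_lam, Finset.smul_sum, ← Finset.sum_neg_distrib]
  rw [Finset.sum_comm]
  refine Finset.sum_congr rfl fun j _ => Finset.sum_congr rfl fun i _ => ?_
  by_cases hi : par i = p
  · by_cases hj : par j = q
    · rw [h.skew i j k, hi, hj]
      simp only [smul_eq_C_C_mul]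
      ring
    · simp [hb j hj]
  · simp [ha i hi]

/-- `σ [Eᵢ_λ Eⱼ] = [σ(Eᵢ)_λ σ(Eⱼ)]`, where `S i` is the vector `σ(Eᵢ)`. -/
def PreservesBracket (Q : ι → ι → ι → ℂ[X][Y]) (S : ι → ι → ℂ[X]) (i j : ι) : Prop :=
  ∀ k, ∑ l, C (S l k) * Q i j l = bracketPoly Q (S i) (S j) k

theorem PreservesBracket.symm (h : IsStructure par Q) {S : ι → ι → ℂ[X]}
    (hS : ∀ i, S i ∈ structureGrade par (par i)) {i j : ι} (hij : PreservesBracket Q S i j) :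
    PreservesBracket Q S j i := by
  intro k
  rw [skewFlip_bracketPoly h (hS j) (hS i), ← hij k, skewFlip_sum, Finset.smul_sum,
    ← Finset.sum_neg_distrib]
  refine Finset.sum_congr rfl fun l _ => ?_
  rw [h.skew j i l, skewFlip_mul, skewFlip_C]
  simp only [smul_eq_C_C_mul]
  ring

variable [DecidableEq ι]

theorem linearEquiv_apply_eq_sum (σ : (ι → ℂ[X]) ≃ₗ[ℂ[X]] (ι → ℂ[X])) (v : ι → ℂ[X]) (k : ι) :
    σ v k = ∑ l, v l * σ (Pi.single l 1) k := by
  conv_lhs => rw [pi_eq_sum_univ' v, map_sum, Finset.sum_apply]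
  simp

theorem bracketPoly_single (Q : ι → ι → ι → ℂ[X][Y]) (i j k : ι) :
    bracketPoly Q (Pi.single i 1) (Pi.single j 1) k = Q i j k := by
  rw [bracketPoly, Finset.sum_eq_single i, Finset.sum_eq_single j]
  · simp
  · intro b _ hb; simp [Pi.single_eq_of_ne hb]
  · simp
  · intro b _ hb; simp [Pi.single_eq_of_ne hb]
  · simp

theorem map_structureBracket_iff (Q : ι → ι → ι → ℂ[X][Y])
    (σ : (ι → ℂ[X]) ≃ₗ[ℂ[X]] (ι → ℂ[X])) :
    (∀ a b n, σ (structureBracket Q a b n) = structureBracket Q (σ a) (σ b) n) ↔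
      ∀ i j, PreservesBracket Q (fun l => σ (Pi.single l 1)) i j := by
  have key : ∀ a b, (∀ n, σ (structureBracket Q a b n) = structureBracket Q (σ a) (σ b) n) ↔
      ∀ k, ∑ l, C (σ (Pi.single l 1) k) * bracketPoly Q a b l = bracketPoly Q (σ a) (σ b) k := by
    intro a b
    have e : ∀ n k, σ (structureBracket Q a b n) k =
        (∑ l, C (σ (Pi.single l 1) k) * bracketPoly Q a b l).coeff n := by
      intro n k
      rw [linearEquiv_apply_eq_sum, finsetSum_coeff]
      refine Finset.sum_congr rfl fun l _ => ?_
      rw [coeff_C_mul, mul_comm]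
      rfl
    constructor
    · intro h k
      ext1 n
      rw [← e, h]
      rfl
    · intro h n
      ext1 k
      rw [e, h]
      rfl
  constructor
  · intro h i j k
    have := (key _ _).1 (h (Pi.single i 1) (Pi.single j 1)) k
    simpa only [bracketPoly_single] using this
  · intro h a b
    refine (key a b).2 fun k => ?_
    -- Both substitutions are ring homomorphisms, so the coefficients of `a` and `b` come out of the
    -- bracket of the images, leaving only brackets of images of generators.
    have h2 : bracketPoly Q (σ a) (σ b) k = ∑ i, ∑ j, aeval (-lam) (a i) *
        aeval (del + lam) (b j) *
          bracketPoly Q (σ (Pi.single i 1)) (σ (Pi.single j 1)) k := by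
      simp only [bracketPoly, linearEquiv_apply_eq_sum σ a, linearEquiv_apply_eq_sum σ b, map_sum,
        map_mul, Finset.mul_sum, Finset.sum_mul]
      rw [Finset.sum_congr rfl fun p _ => Finset.sum_congr rfl fun q _ => Finset.sum_comm,
        Finset.sum_congr rfl fun p _ => Finset.sum_comm, Finset.sum_comm]
      refine Finset.sum_congr rfl fun i _ => ?_
      rw [Finset.sum_congr rfl fun p _ => Finset.sum_comm, Finset.sum_comm]
      refine Finset.sum_congr rfl fun j _ => Finset.sum_congr rfl fun p _ =>
        Finset.sum_congr rfl fun q _ => ?_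
      ring
    rw [h2]
    have h3 : ∀ i j, bracketPoly Q (σ (Pi.single i 1)) (σ (Pi.single j 1)) k =
        ∑ l, C (σ (Pi.single l 1) k) * Q i j l := fun i j => (h i j k).symm
    simp only [h3]
    simp only [bracketPoly, Finset.mul_sum]
    rw [Finset.sum_comm]
    refine Finset.sum_congr rfl fun i _ => ?_
    rw [Finset.sum_comm]
    refine Finset.sum_congr rfl fun j _ => Finset.sum_congr rfl fun l _ => ?_
    ring

theorem map_structureGrade_iff (σ : (ι → ℂ[X]) ≃ₗ[ℂ[X]] (ι → ℂ[X])) :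
    (∀ p, ∀ a ∈ structureGrade par p, σ a ∈ structureGrade par p) ↔
      ∀ i, σ (Pi.single i 1) ∈ structureGrade par (par i) := by
  constructor
  · intro h i
    refine h _ _ fun j hj => ?_
    rw [Pi.single_eq_of_ne]
    rintro rfl
    exact hj rfl
  · intro h p a ha k hk
    rw [linearEquiv_apply_eq_sum]
    refine Finset.sum_eq_zero fun l _ => ?_
    by_cases hl : par l = p
    · rw [h l k (by rwa [hl]), mul_zero]
    · rw [ha l hl, zero_mul]

end Generators

/-! ### Automorphisms of algebras of rank `(2+1)` -/

/-- The matrix of `A ↦ aA + bB`, `B ↦ cA + dB`, `X ↦ eX`, with rows the images of `A`, `B`, `X`. -/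
noncomputable def evenMatrix (a b c d e : ℂ[X]) : Fin 3 → Fin 3 → ℂ[X] :=
  ![![a, b, 0], ![c, d, 0], ![0, 0, e]]

/-- `A ↦ aA + bB`, `B ↦ cA + dB`, `X ↦ eX` is compatible with the defining relations. -/
def RespectsRelations (r : Relations) (a b c d e : ℂ[X]) : Prop :=
  PreservesBracket r.toConstants (evenMatrix a b c d e) 0 0 ∧
  PreservesBracket r.toConstants (evenMatrix a b c d e) 0 1 ∧
  PreservesBracket r.toConstants (evenMatrix a b c d e) 1 1 ∧
  PreservesBracket r.toConstants (evenMatrix a b c d e) 0 2 ∧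
  PreservesBracket r.toConstants (evenMatrix a b c d e) 1 2 ∧
  PreservesBracket r.toConstants (evenMatrix a b c d e) 2 2

theorem evenMatrix_mem_grade (a b c d e : ℂ[X]) (i : Fin 3) :
    evenMatrix a b c d e i ∈ structureGrade parityABX (parityABX i) := by
  intro j hj
  fin_cases i <;> fin_cases j <;> first | rfl | exact absurd rfl hj

/-- The zeros of the matrix take care of the grading, and the three pairs of generators in the
opposite order follow by `PreservesBracket.symm`. -/
theorem mem_Aut_of_evenMatrix {r : Relations} (h : IsStructure parityABX r.toConstants)
    {σ : (Fin 3 → ℂ[X]) ≃ₗ[ℂ[X]] (Fin 3 → ℂ[X])} {a b c d e : ℂ[X]}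
    (hσ : ∀ i, σ (Pi.single i 1) = evenMatrix a b c d e i) :
    σ ∈ (LieConformalSuperalgebra.ofStructure h).Aut ↔ RespectsRelations r a b c d e := by
  have hg := evenMatrix_mem_grade a b c d e
  have h0 : (fun i => σ (Pi.single i 1)) = evenMatrix a b c d e := funext hσ
  constructor
  · rintro ⟨-, h2⟩
    have := (map_structureBracket_iff r.toConstants σ).1 h2
    rw [h0] at this
    exact ⟨this _ _, this _ _, this _ _, this _ _, this _ _, this _ _⟩
  · rintro ⟨h1, h2, h3, h4, h5, h6⟩
    refine ⟨(map_structureGrade_iff σ).2 fun i => hσ i ▸ hg i,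
      (map_structureBracket_iff r.toConstants σ).2 ?_⟩
    rw [h0]
    intro i j
    fin_cases i <;> fin_cases j
    exacts [h1, h2, h4, h2.symm h hg, h3, h5, h4.symm h hg, h5.symm h hg, h6]

theorem exists_evenMatrix {r : Relations} (h : IsStructure parityABX r.toConstants)
    {σ : (Fin 3 → ℂ[X]) ≃ₗ[ℂ[X]] (Fin 3 → ℂ[X])}
    (hσ : σ ∈ (LieConformalSuperalgebra.ofStructure h).Aut) :
    ∃ a b c d e, (∀ i, σ (Pi.single i 1) = evenMatrix a b c d e i) ∧
      IsUnit (a * d - b * c) ∧ IsUnit e := by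
  have hg := (map_structureGrade_iff σ).1 hσ.1
  have h02 : σ (Pi.single 0 1) 2 = 0 := hg 0 2 (by decide)
  have h12 : σ (Pi.single 1 1) 2 = 0 := hg 1 2 (by decide)
  have h20 : σ (Pi.single 2 1) 0 = 0 := hg 2 0 (by decide)
  have h21 : σ (Pi.single 2 1) 1 = 0 := hg 2 1 (by decide)
  refine ⟨σ (Pi.single 0 1) 0, σ (Pi.single 0 1) 1, σ (Pi.single 1 1) 0, σ (Pi.single 1 1) 1,
    σ (Pi.single 2 1) 2, ?_, ?_⟩
  · intro i
    ext1 k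
    fin_cases i <;> fin_cases k <;> simp [evenMatrix, h02, h12, h20, h21]
  -- The determinant of the block matrix is `(ad - bc)e`.
  · have hu := σ.isUnit_det'
    rw [← LinearMap.det_toMatrix', Matrix.det_fin_three] at hu
    simp only [LinearMap.toMatrix'_apply, LinearEquiv.coe_coe, h02, h12, h20, h21] at hu
    rw [← IsUnit.mul_iff]
    convert hu using 1
    ring

/-! ### Triangular automorphisms and their group law. -/

/-- The map `A ↦ aA + bB`, `B ↦ dB`, `X ↦ eX`. -/
noncomputable def triangular (a d e : ℂˣ) (b : ℂ[X]) : (Fin 3 → ℂ[X]) ≃ₗ[ℂ[X]] (Fin 3 → ℂ[X]) where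
  toFun v := ![C (a : ℂ) * v 0, b * v 0 + C (d : ℂ) * v 1, C (e : ℂ) * v 2]
  map_add' v w := by ext1 k; fin_cases k <;> simp <;> ring
  map_smul' c v := by ext1 k; fin_cases k <;> simp <;> ring
  invFun v := ![C (↑a⁻¹ : ℂ) * v 0, C (↑d⁻¹ : ℂ) * (v 1 - b * (C (↑a⁻¹ : ℂ) * v 0)),
    C (↑e⁻¹ : ℂ) * v 2]
  left_inv v := by
    ext1 k; fin_cases k <;> simp [← mul_assoc, ← C_mul]
  right_inv v := by
    ext1 k; fin_cases k <;> simp [← mul_assoc, ← C_mul]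

theorem triangular_single (a d e : ℂˣ) (b : ℂ[X]) (i : Fin 3) :
    triangular a d e b (Pi.single i 1) = evenMatrix (C (a : ℂ)) b 0 (C (d : ℂ)) (C (e : ℂ)) i := by
  ext1 k
  fin_cases i <;> fin_cases k <;> simp [triangular, evenMatrix]

theorem triangular_mul (a d e a' d' e' : ℂˣ) (b b' : ℂ[X]) :
    triangular a d e b * triangular a' d' e' b' =
      triangular (a * a') (d * d') (e * e') (b * C (a' : ℂ) + C (d : ℂ) * b') := by
  refine LinearEquiv.ext fun v => funext fun k => ?_
  fin_cases k <;> simp [triangular] <;> ring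

theorem triangular_inj {a d e a' d' e' : ℂˣ} {b b' : ℂ[X]}
    (h : triangular a d e b = triangular a' d' e' b') : a = a' ∧ d = d' ∧ e = e' ∧ b = b' := by
  have key : ∀ i k, evenMatrix (C (a : ℂ)) b 0 (C (d : ℂ)) (C (e : ℂ)) i k =
      evenMatrix (C (a' : ℂ)) b' 0 (C (d' : ℂ)) (C (e' : ℂ)) i k := by
    intro i k
    rw [← triangular_single, ← triangular_single, h]
  exact ⟨Units.ext (C_injective (key 0 0)), Units.ext (C_injective (key 1 1)),
    Units.ext (C_injective (key 2 2)), key 0 1⟩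

theorem exists_units_C {p : ℂ[X]} (h : IsUnit p) : ∃ a : ℂˣ, p = C (a : ℂ) := by
  obtain ⟨r, ⟨u, rfl⟩, hr⟩ := Polynomial.isUnit_iff.1 h
  exact ⟨u, hr.symm⟩

/-- An invertible `2 × 2` block over `ℂ[∂]` may have nonconstant entries everywhere; the vanishing
of `c` is what makes the diagonal constant. The hypothesis `hc` is the part that has to be checked
algebra by algebra. -/
theorem mem_Aut_iff_triangular {r : Relations} (h : IsStructure parityABX r.toConstants)
    (hc : ∀ a b c d e, IsUnit (a * d - b * c) → IsUnit e → RespectsRelations r a b c d e → c = 0)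
    (σ : (Fin 3 → ℂ[X]) ≃ₗ[ℂ[X]] (Fin 3 → ℂ[X])) :
    σ ∈ (LieConformalSuperalgebra.ofStructure h).Aut ↔ ∃ a d e b, triangular a d e b = σ ∧
      RespectsRelations r (C (a : ℂ)) b 0 (C (d : ℂ)) (C (e : ℂ)) := by
  constructor
  · intro hσ
    obtain ⟨a, b, c, d, e, hm, hu, he⟩ := exists_evenMatrix h hσ
    have hr := (mem_Aut_of_evenMatrix h hm).1 hσ
    obtain rfl := hc _ _ _ _ _ hu he hr
    rw [mul_zero, sub_zero, IsUnit.mul_iff] at hu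
    obtain ⟨a, rfl⟩ := exists_units_C hu.1
    obtain ⟨d, rfl⟩ := exists_units_C hu.2
    obtain ⟨e, rfl⟩ := exists_units_C he
    refine ⟨a, d, e, b, LinearEquiv.ext fun v => funext fun k => ?_, hr⟩
    rw [linearEquiv_apply_eq_sum, linearEquiv_apply_eq_sum σ]
    simp only [hm, triangular_single]
  · rintro ⟨a, d, e, b, rfl, hr⟩
    exact (mem_Aut_of_evenMatrix h (triangular_single a d e b)).2 hr

theorem nonempty_mulEquiv_of_range {G H : Type*} [Group G] [Group H] {K : Subgroup H} (f : G →* H)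
    (hf : Function.Injective f) (hK : ∀ x, x ∈ K ↔ ∃ g, f g = x) : Nonempty (K ≃* G) :=
  ⟨((MonoidHom.ofInjective hf).trans
    (MulEquiv.subgroupCongr (Subgroup.ext fun x => (hK x).symm))).symm⟩

/-! ### Polynomial identities -/

/-- Specialising `∂ = 0`, `λ = -∂` undoes `a(∂) ↦ a(-λ)`; this and its companion at `λ = 0` give the
injectivity needed to conclude that a coefficient polynomial vanishes. -/
theorem substDL_zero_neg_X (a : ℂ[X]) : substDL 0 (-X) (aeval (-lam) a) = a := by
  simp [subst_neg_Y]

theorem substDL_X_zero (a : ℂ[X]) : substDL X 0 (aeval (del + lam) a) = a := by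
  simp [subst_add_Y]

theorem aeval_neg_lam_injective : Function.Injective (aeval (-lam) : ℂ[X] → ℂ[X][Y]) :=
  Function.LeftInverse.injective substDL_zero_neg_X

theorem aeval_del_add_lam_injective : Function.Injective (aeval (del + lam) : ℂ[X] → ℂ[X][Y]) :=
  Function.LeftInverse.injective substDL_X_zero

theorem aeval_neg_lam_eq_zero {a : ℂ[X]} : aeval (-lam) a = (0 : ℂ[X][Y]) ↔ a = 0 :=
  map_eq_zero_iff (aeval (-lam) : ℂ[X] →ₐ[ℂ] ℂ[X][Y]) aeval_neg_lam_injective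

theorem aeval_del_add_lam_eq_zero {a : ℂ[X]} : aeval (del + lam) a = (0 : ℂ[X][Y]) ↔ a = 0 :=
  map_eq_zero_iff (aeval (del + lam) : ℂ[X] →ₐ[ℂ] ℂ[X][Y]) aeval_del_add_lam_injective

theorem inLam_ne_zero {φ : ℂ[X]} (h : φ ≠ 0) : inLam φ ≠ 0 :=
  (Polynomial.map_ne_zero_iff C_injective).2 h

theorem inLam_eq_aeval (φ : ℂ[X]) : inLam φ = aeval lam φ := by
  change eval₂ (C.comp C) lam φ = eval₂ (algebraMap ℂ ℂ[X][Y]) lam φ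
  rw [IsScalarTower.algebraMap_eq ℂ ℂ[X] ℂ[X][Y]]
  rfl

theorem vir_module_ne_zero (s t : ℂ) : del + cst s * lam + cst t ≠ 0 := by
  intro h
  -- At `∂ = 1 - t`, `λ = 0` the polynomial takes the value `1`.
  have := congrArg (substDL (1 - C t) 0) h
  simp [subst_del, subst_lam, subst_cst] at this

theorem super_vir_module_ne_zero (s : ℂ) : del + cst s * lam ≠ 0 := by
  intro h
  have := congrArg (substDL 1 0) h
  simp [subst_del, subst_lam, subst_cst] at this

theorem vir_ne_zero : del + 2 * lam ≠ 0 := by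
  intro h
  have := congrArg (substDL 1 0) h
  simp [subst_del, subst_lam] at this

/-- `b(y) φ(-x) = b(x) φ(-y)` holds, with `x = -λ` and `y = ∂ + λ`, only for the multiples of
`φ(-∂)`. -/
theorem symm_relation_iff {φ : ℂ[X]} (hφ : φ ≠ 0) (b : ℂ[X]) :
    aeval (del + lam) b * inLam φ - aeval (-lam) b * skewFlip (inLam φ) = 0 ↔
      ∃ z : ℂ, b = C z * φ.comp (-X) := by
  constructor
  · intro h
    obtain ⟨x, hx⟩ : ∃ x, φ.eval x ≠ 0 := by
      by_contra! h0
      exact hφ (Polynomial.funext fun x => by simp [h0 x])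
    -- Setting `λ = x` and `∂ + λ = X` leaves `b(X) φ(x) = b(-x) φ(-X)`, in which `φ(x)` can be
    -- divided out.
    have := congrArg (substDL (X - C x) (C x)) h
    simp only [map_sub, map_mul, subst_add_Y, subst_neg_Y, subst_inLam, subst_skewFlip,
      map_zero, sub_add_cancel, comp_X, comp_C] at this
    rw [← C_neg, comp_C, show -(X - C x) - C x = -X by ring] at this
    refine ⟨b.eval (-x) / φ.eval x, ?_⟩
    have hC : C (φ.eval x) ≠ 0 := C_ne_zero.2 hx
    refine mul_right_cancel₀ hC ?_
    rw [sub_eq_zero.1 this, mul_right_comm, ← C_mul, div_mul_cancel₀ _ hx]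
  · rintro ⟨z, rfl⟩
    -- Both products equal `z φ(λ) φ(-∂ - λ)`.
    rw [inLam_eq_aeval, skewFlip_aeval, map_mul, map_mul, aeval_comp, aeval_comp,
      aeval_del_add_lam_C, aeval_neg_lam_C]
    simp only [map_neg, aeval_X, neg_neg, skewFlip, X_comp]
    rw [show -(del + lam) = -del - lam by ring]
    ring

/-! ### The automorphisms of each algebra -/

theorem units_C_C_eq_mul {x y z : ℂˣ} :
    (C (C (x : ℂ)) : ℂ[X][Y]) = C (C (y : ℂ)) * C (C (z : ℂ)) ↔ x = y * z := by
  rw [← C_mul, ← C_mul, C_inj, C_inj, ← Units.val_mul, Units.val_inj]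

theorem units_C_C_eq_one {x : ℂˣ} : (C (C (x : ℂ)) : ℂ[X][Y]) = 1 ↔ x = 1 := by
  rw [← C_1, ← C_1, C_inj, C_inj, Units.val_eq_one]

/-! ### Automorphisms in type `𝒜`. -/

theorem respectsRelations_A1_iff {f : ℂ[X][Y]} (hf : f ≠ 0) (φ a b c d e : ℂ[X]) :
    RespectsRelations (relA1 f φ) a b c d e ↔ c = 0 ∧
      C d = aeval (-lam) a * aeval (del + lam) a ∧
      (φ = 0 ∨ C e = aeval (-lam) a * aeval (del + lam) e) := by
  have h0 : inLam φ = 0 ↔ φ = 0 := Polynomial.map_eq_zero_iff C_injective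
  simp [RespectsRelations, PreservesBracket, bracketPoly, evenMatrix, Fin.forall_fin_succ,
    Fin.sum_univ_three, Relations.toConstants_entries, relA1, skewFlip_zero, Matrix.cons_val,
    aeval_neg_lam_eq_zero, aeval_del_add_lam_eq_zero, hf, h0]
  constructor
  · rintro ⟨⟨rfl, h1⟩, -, -, h2, -⟩
    exact ⟨rfl, h1, h2.symm⟩
  · rintro ⟨rfl, h1, h2⟩
    simp [h1, h2.symm]

/-- No relation restricts `b`, since `B` brackets to zero with every generator. Comparing `[A_λ A]`
gives `d = a²`, and a nonzero `φ` in `[A_λ X]` gives `a = 1`. -/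
theorem mem_Aut_A1_iff {f : ℂ[X][Y]} (hf : IsSkewSymmetric f) (h0 : f ≠ 0) (φ : ℂ[X])
    (σ : (Fin 3 → ℂ[X]) ≃ₗ[ℂ[X]] (Fin 3 → ℂ[X])) :
    σ ∈ (algA1 f hf φ).Aut ↔
      ∃ a e b, triangular a (a * a) e b = σ ∧ (φ = 0 ∨ a = 1) := by
  rw [algA1, mem_Aut_iff_triangular]
  · simp only [respectsRelations_A1_iff h0, aeval_del_add_lam_C, aeval_neg_lam_C,
      units_C_C_eq_mul, right_eq_mul, true_and]
    constructor
    · rintro ⟨a, d, e, b, rfl, rfl, h⟩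
      exact ⟨a, e, b, rfl, h⟩
    · rintro ⟨a, e, b, rfl, h⟩
      exact ⟨a, _, e, b, rfl, rfl, h⟩
  · exact fun a b c d e _ _ h => ((respectsRelations_A1_iff h0 _ _ _ _ _ _).1 h).1

theorem respectsRelations_A2_iff {f : ℂ[X][Y]} (hf : f ≠ 0) (ψ a b c d e : ℂ[X]) :
    RespectsRelations (relA2 f ψ) a b c d e ↔ c = 0 ∧
      C d = aeval (-lam) a * aeval (del + lam) a ∧
      (ψ = 0 ∨ C d = aeval (-lam) e * aeval (del + lam) e) := by
  have h0 : inDel ψ = 0 ↔ ψ = 0 := C_eq_zero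
  simp [RespectsRelations, PreservesBracket, bracketPoly, evenMatrix, Fin.forall_fin_succ,
    Fin.sum_univ_three, Relations.toConstants_entries, relA2, skewFlip_zero, Matrix.cons_val,
    aeval_neg_lam_eq_zero, aeval_del_add_lam_eq_zero, hf, h0]
  constructor
  · rintro ⟨⟨rfl, h1⟩, h2, h3⟩
    simp_all
    tauto
  · rintro ⟨rfl, h1, h2⟩
    simp [h1.symm, h2.symm]

theorem mem_Aut_A2_iff {f : ℂ[X][Y]} (hf : IsSkewSymmetric f) (h0 : f ≠ 0) (ψ : ℂ[X])
    (σ : (Fin 3 → ℂ[X]) ≃ₗ[ℂ[X]] (Fin 3 → ℂ[X])) :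
    σ ∈ (algA2 f hf ψ).Aut ↔
      ∃ a e b, triangular a (a * a) e b = σ ∧ (ψ = 0 ∨ a * a = e * e) := by
  rw [algA2, mem_Aut_iff_triangular]
  · simp only [respectsRelations_A2_iff h0, aeval_del_add_lam_C, aeval_neg_lam_C,
      units_C_C_eq_mul, right_eq_mul, true_and]
    constructor
    · rintro ⟨a, d, e, b, rfl, rfl, h⟩
      exact ⟨a, e, b, rfl, h⟩
    · rintro ⟨a, e, b, rfl, h⟩
      exact ⟨a, _, e, b, rfl, rfl, h⟩
  · exact fun a b c d e _ _ h => ((respectsRelations_A2_iff h0 _ _ _ _ _ _).1 h).1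

theorem mem_Aut_A3_iff {φ : ℂ[X]} (hφ : φ ≠ 0) (σ : (Fin 3 → ℂ[X]) ≃ₗ[ℂ[X]] (Fin 3 → ℂ[X])) :
    σ ∈ (algA3 φ).Aut ↔
      ∃ (e : ℂˣ) (z : ℂ), triangular 1 (e * e) e (C z * φ.comp (-X)) = σ := by
  have h0 := inLam_ne_zero hφ
  have h1 : skewFlip (2 * inLam φ) = 2 * skewFlip (inLam φ) := by simp [skewFlip]
  -- This is the `B`-coordinate of `[σ(A)_λ σ(A)] = 0` for `a = 1`, the only condition on `b`.
  have h2 (b : ℂ[X]) : 0 = aeval (del + lam) b * (2 * inLam φ) +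
      aeval (-lam) b * -(2 * skewFlip (inLam φ)) ↔ ∃ z : ℂ, b = C z * φ.comp (-X) := by
    rw [← symm_relation_iff hφ, eq_comm]
    exact ⟨fun h => mul_left_cancel₀ (two_ne_zero (α := ℂ[X][Y])) (by linear_combination h),
      fun h => by linear_combination 2 * h⟩
  rw [algA3, mem_Aut_iff_triangular]
  · simp [RespectsRelations, PreservesBracket, bracketPoly, evenMatrix, Fin.forall_fin_succ,
      Fin.sum_univ_three, Relations.toConstants_entries, relA3, skewFlip_zero, Matrix.cons_val,
      h0, units_C_C_eq_mul, units_C_C_eq_one, h1]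
    constructor
    · rintro ⟨e, b, rfl, hb⟩
      rw [h2] at hb
      obtain ⟨z, rfl⟩ := hb
      exact ⟨e, z, rfl⟩
    · rintro ⟨e, z, rfl⟩
      refine ⟨e, _, rfl, ?_⟩
      rw [h2]
      exact ⟨z, rfl⟩
  · intro a b c d e _ _ h
    simp [RespectsRelations, PreservesBracket, bracketPoly, evenMatrix, Fin.forall_fin_succ,
      Fin.sum_univ_three, Relations.toConstants_entries, relA3, skewFlip_zero, Matrix.cons_val,
      h0] at h
    -- The `A`-coordinate of the relation for `[X_λ X] = 2B`.
    exact h.2.2.2.2.2.1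

theorem mem_Aut_A4_iff {p : ℂ[X]} (hp : p ≠ 0) (φ : ℂ[X])
    (σ : (Fin 3 → ℂ[X]) ≃ₗ[ℂ[X]] (Fin 3 → ℂ[X])) :
    σ ∈ (algA4 p φ).Aut ↔
      ∃ (d e : ℂˣ) (z : ℂ), triangular 1 d e (C z * p.comp (-X)) = σ := by
  have h0 := inLam_ne_zero hp
  have h2 (b : ℂ[X]) : 0 = aeval (del + lam) b * inLam p +
      aeval (-lam) b * -skewFlip (inLam p) ↔ ∃ z : ℂ, b = C z * p.comp (-X) := by
    rw [← symm_relation_iff hp, eq_comm]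
    congr! 1
    ring
  rw [algA4, mem_Aut_iff_triangular]
  · simp [RespectsRelations, PreservesBracket, bracketPoly, evenMatrix, Fin.forall_fin_succ,
      Fin.sum_univ_three, Relations.toConstants_entries, relA4, skewFlip_zero, Matrix.cons_val,
      h0, units_C_C_eq_one]
    constructor
    · rintro ⟨d, e, b, rfl, hb⟩
      rw [h2] at hb
      obtain ⟨z, rfl⟩ := hb
      exact ⟨d, e, z, rfl⟩
    · rintro ⟨d, e, z, rfl⟩
      refine ⟨d, e, _, rfl, ?_⟩
      rw [h2]
      exact ⟨z, rfl⟩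
  · intro a b c d e _ _ h
    simp [RespectsRelations, PreservesBracket, bracketPoly, evenMatrix, Fin.forall_fin_succ,
      Fin.sum_univ_three, Relations.toConstants_entries, relA4, skewFlip_zero, Matrix.cons_val,
      h0] at h
    -- The `A`-coordinate of the relation for `[A_λ B] = p(λ)B` reads `c p(λ) = 0`.
    exact h.2.1.1

/-! ### Automorphisms in type `ℬ`. -/

theorem mem_Aut_B1_iff (α β : ℂ) (σ : (Fin 3 → ℂ[X]) ≃ₗ[ℂ[X]] (Fin 3 → ℂ[X])) :
    σ ∈ (algB1 α β).Aut ↔ ∃ e : ℂˣ, triangular 1 1 e 0 = σ := by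
  rw [algB1, mem_Aut_iff_triangular]
  -- Since `[A_λ B] = 0` while `[B_λ B] ≠ 0`, the entry `b` vanishes; the two Virasoro brackets then
  -- give `a = a²` and `d = d²`, hence `a = d = 1`.
  · simp [RespectsRelations, PreservesBracket, bracketPoly, evenMatrix, Fin.forall_fin_succ,
      Fin.sum_univ_three, Relations.toConstants_entries, relB1, skewFlip_zero, Matrix.cons_val,
      vir_ne_zero, vir_module_ne_zero, super_vir_module_ne_zero, aeval_neg_lam_eq_zero,
      aeval_del_add_lam_eq_zero, units_C_C_eq_mul, units_C_C_eq_one]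
  · intro a b c d e _ he h
    simp [RespectsRelations, PreservesBracket, bracketPoly, evenMatrix, Fin.forall_fin_succ,
      Fin.sum_univ_three, Relations.toConstants_entries, relB1, skewFlip_zero, Matrix.cons_val,
      vir_ne_zero, vir_module_ne_zero, super_vir_module_ne_zero, aeval_neg_lam_eq_zero,
      aeval_del_add_lam_eq_zero, he.ne_zero] at h
    -- `[B_λ X] = 0` while `[A_λ X] ≠ 0`, so the image of `B` has no `A`-component.
    exact h.2.2.2.2

theorem mem_Aut_B2_iff (σ : (Fin 3 → ℂ[X]) ≃ₗ[ℂ[X]] (Fin 3 → ℂ[X])) :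
    σ ∈ (algB2).Aut ↔ ∃ e : ℂˣ, triangular 1 1 e 0 = σ ∧ e * e = 1 := by
  rw [algB2, mem_Aut_iff_triangular]
  · simp [RespectsRelations, PreservesBracket, bracketPoly, evenMatrix, Fin.forall_fin_succ,
      Fin.sum_univ_three, Relations.toConstants_entries, relB2, skewFlip_zero, Matrix.cons_val,
      vir_ne_zero, vir_module_ne_zero, super_vir_module_ne_zero, aeval_neg_lam_eq_zero,
      aeval_del_add_lam_eq_zero, units_C_C_eq_mul, units_C_C_eq_one]
    simp only [eq_comm]
  · intro a b c d e _ he h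
    simp [RespectsRelations, PreservesBracket, bracketPoly, evenMatrix, Fin.forall_fin_succ,
      Fin.sum_univ_three, Relations.toConstants_entries, relB2, skewFlip_zero, Matrix.cons_val,
      vir_ne_zero, vir_module_ne_zero, super_vir_module_ne_zero, aeval_neg_lam_eq_zero,
      aeval_del_add_lam_eq_zero, he.ne_zero] at h
    exact h.2.2.2.2.1

/-! ### Automorphisms in type `𝒞`. -/

theorem mem_Aut_C1_iff (α β : ℂ) (σ : (Fin 3 → ℂ[X]) ≃ₗ[ℂ[X]] (Fin 3 → ℂ[X])) :
    σ ∈ (algC1 α β).Aut ↔ ∃ d e : ℂˣ, triangular 1 d e 0 = σ := by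
  rw [algC1, mem_Aut_iff_triangular]
  · simp [RespectsRelations, PreservesBracket, bracketPoly, evenMatrix, Fin.forall_fin_succ,
      Fin.sum_univ_three, Relations.toConstants_entries, relC1, skewFlip_zero, Matrix.cons_val,
      vir_ne_zero, vir_module_ne_zero, super_vir_module_ne_zero, aeval_neg_lam_eq_zero,
      aeval_del_add_lam_eq_zero, units_C_C_eq_mul, units_C_C_eq_one]
  · intro a b c d e _ he h
    simp [RespectsRelations, PreservesBracket, bracketPoly, evenMatrix, Fin.forall_fin_succ,
      Fin.sum_univ_three, Relations.toConstants_entries, relC1, skewFlip_zero, Matrix.cons_val,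
      vir_ne_zero, vir_module_ne_zero, super_vir_module_ne_zero, aeval_neg_lam_eq_zero,
      aeval_del_add_lam_eq_zero, he.ne_zero] at h
    -- `[B_λ B] = 0` becomes `c(-λ) c(∂ + λ)(∂ + 2λ) = 0`.
    exact h.2.2.1

theorem mem_Aut_C2_iff (σ : (Fin 3 → ℂ[X]) ≃ₗ[ℂ[X]] (Fin 3 → ℂ[X])) :
    σ ∈ (algC2).Aut ↔ ∃ d e : ℂˣ, triangular 1 d e 0 = σ ∧ e * e = 1 := by
  rw [algC2, mem_Aut_iff_triangular]
  · simp [RespectsRelations, PreservesBracket, bracketPoly, evenMatrix, Fin.forall_fin_succ,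
      Fin.sum_univ_three, Relations.toConstants_entries, relC2, skewFlip_zero, Matrix.cons_val,
      vir_ne_zero, vir_module_ne_zero, super_vir_module_ne_zero, aeval_neg_lam_eq_zero,
      aeval_del_add_lam_eq_zero, units_C_C_eq_mul, units_C_C_eq_one]
    simp only [eq_comm]
  · intro a b c d e _ he h
    simp [RespectsRelations, PreservesBracket, bracketPoly, evenMatrix, Fin.forall_fin_succ,
      Fin.sum_univ_three, Relations.toConstants_entries, relC2, skewFlip_zero, Matrix.cons_val,
      vir_ne_zero, vir_module_ne_zero, super_vir_module_ne_zero, aeval_neg_lam_eq_zero,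
      aeval_del_add_lam_eq_zero, he.ne_zero] at h
    exact h.2.2.1

theorem mem_Aut_C3_iff {φ : ℂ[X]} (hφ : φ ≠ 0) (σ : (Fin 3 → ℂ[X]) ≃ₗ[ℂ[X]] (Fin 3 → ℂ[X])) :
    σ ∈ (algC3 φ).Aut ↔ ∃ e : ℂˣ, triangular 1 1 e 0 = σ := by
  have h0 := inLam_ne_zero hφ
  rw [algC3, mem_Aut_iff_triangular]
  · simp [RespectsRelations, PreservesBracket, bracketPoly, evenMatrix, Fin.forall_fin_succ,
      Fin.sum_univ_three, Relations.toConstants_entries, relC3, skewFlip_zero, Matrix.cons_val,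
      vir_ne_zero, vir_module_ne_zero, super_vir_module_ne_zero, aeval_neg_lam_eq_zero,
      aeval_del_add_lam_eq_zero, h0, units_C_C_eq_mul, units_C_C_eq_one]
  · intro a b c d e _ he h
    simp [RespectsRelations, PreservesBracket, bracketPoly, evenMatrix, Fin.forall_fin_succ,
      Fin.sum_univ_three, Relations.toConstants_entries, relC3, skewFlip_zero, Matrix.cons_val,
      vir_ne_zero, vir_module_ne_zero, super_vir_module_ne_zero, aeval_neg_lam_eq_zero,
      aeval_del_add_lam_eq_zero, h0, he.ne_zero] at h
    exact h.2.2.1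

/-! ### The isomorphisms -/

/-- The embedding of `ℤ/2` as `{±1}`. -/
def signUnits : Multiplicative (ZMod 2) →* ℂˣ where
  toFun x := if x = 1 then 1 else -1
  map_one' := if_pos rfl
  map_mul' x y := by
    have h : ∀ x : Multiplicative (ZMod 2), x = 1 ∨ x = .ofAdd 1 := by decide
    have h1 : (Multiplicative.ofAdd 1 : Multiplicative (ZMod 2)) ≠ 1 := by decide
    have h2 : (Multiplicative.ofAdd 1 * .ofAdd 1 : Multiplicative (ZMod 2)) = 1 := by decide
    rcases h x with rfl | rfl <;> rcases h y with rfl | rfl <;>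
      simp only [h1, h2, mul_one, one_mul, if_true, if_false, neg_mul_neg]

theorem signUnits_injective : Function.Injective signUnits := by
  rw [injective_iff_map_eq_one]
  intro x hx
  by_contra h
  have h1 : (-1 : ℂˣ) = 1 := (if_neg h).symm.trans hx
  rw [Units.ext_iff] at h1
  norm_num at h1

theorem exists_signUnits_iff {e : ℂˣ} : (∃ s, signUnits s = e) ↔ e * e = 1 := by
  constructor
  · rintro ⟨s, rfl⟩
    rw [← map_mul]
    have h : ∀ x : Multiplicative (ZMod 2), x * x = 1 := by decide
    rw [h, map_one]
  · intro h
    rcases mul_self_eq_one_iff.1 (show (e : ℂ) * e = 1 by rw [← Units.val_mul, h, Units.val_one])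
      with h | h
    · exact ⟨1, by rw [map_one]; exact Units.ext h.symm⟩
    · exact ⟨.ofAdd 1, Units.ext h.symm⟩

theorem scalarAction_apply {V : Type*} [AddCommGroup V] [Module ℂ V] (t : ℂˣ)
    (v : Multiplicative V) : scalarAction V t v = .ofAdd ((t : ℂ) • v.toAdd) := rfl

theorem squareAction_apply (t : ℂˣ) (v : Multiplicative ℂ) :
    squareAction t v = .ofAdd ((t : ℂ) ^ 2 * v.toAdd) := by
  change Multiplicative.ofAdd (((t ^ 2 : ℂˣ) : ℂ) • v.toAdd) = _
  simp

/-- `(u, t), s ↦ (A ↦ tA + tuB, B ↦ t²B, X ↦ g(t, s)X)`. -/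
noncomputable def shearHom {G : Type*} [Group G] (g : ℂˣ × G →* ℂˣ) :
    (Multiplicative ℂ[X] ⋊[scalarAction ℂ[X]] ℂˣ) × G →* ((Fin 3 → ℂ[X]) ≃ₗ[ℂ[X]] (Fin 3 → ℂ[X])) :=
  -- With `d = t²` the off-diagonal entries compose by `b t' + t² b'`; writing `b = tu` turns this
  -- into `u + t u'`, the law of the semidirect product with scalar action. The homomorphism `g`
  -- leaves room for the different scalings of `X` in `𝒜₁` and `𝒜₂`.
  MonoidHom.mk' (fun x => triangular x.1.right (x.1.right * x.1.right) (g (x.1.right, x.2))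
    (C (x.1.right : ℂ) * x.1.left.toAdd)) (by
      rintro ⟨⟨u, t⟩, s⟩ ⟨⟨u', t'⟩, s'⟩
      rw [triangular_mul]
      congr 1
      · exact mul_mul_mul_comm _ _ _ _
      · exact map_mul g (t, s) (t', s')
      · simp [scalarAction_apply, smul_eq_C_mul]
        ring)

/-- The scalar `t` is visible as the coefficient of `A`, so `g` need only separate the values of `s`
for fixed `t`. -/
theorem shearHom_injective {G : Type*} [Group G] {g : ℂˣ × G →* ℂˣ}
    (hg : ∀ t s s', g (t, s) = g (t, s') → s = s') : Function.Injective (shearHom g) := by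
  rintro ⟨⟨u, t⟩, s⟩ ⟨⟨u', t'⟩, s'⟩ h
  obtain ⟨h1, -, h2, h3⟩ := triangular_inj h
  obtain rfl : t = t' := h1
  obtain rfl := hg _ _ _ h2
  have h4 : C (t : ℂ) ≠ 0 := C_ne_zero.2 t.ne_zero
  have h5 : u.toAdd = u'.toAdd := mul_left_cancel₀ h4 h3
  obtain rfl : u = u' := h5
  rfl

theorem exists_shearHom_iff {G : Type*} [Group G] {g : ℂˣ × G →* ℂˣ}
    {σ : (Fin 3 → ℂ[X]) ≃ₗ[ℂ[X]] (Fin 3 → ℂ[X])} :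
    (∃ x, shearHom g x = σ) ↔
      ∃ a e b, triangular a (a * a) e b = σ ∧ ∃ s, g (a, s) = e := by
  constructor
  · rintro ⟨⟨⟨u, t⟩, s⟩, rfl⟩
    exact ⟨_, _, _, rfl, s, rfl⟩
  · rintro ⟨a, _, b, rfl, s, rfl⟩
    refine ⟨⟨⟨.ofAdd (C (↑a⁻¹ : ℂ) * b), a⟩, s⟩, ?_⟩
    change triangular _ _ _ (C (a : ℂ) * (C (↑a⁻¹ : ℂ) * b)) = _
    rw [← mul_assoc, ← C_mul, Units.mul_inv, C_1, one_mul]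

theorem comp_neg_X_ne_zero {φ : ℂ[X]} (h : φ ≠ 0) : φ.comp (-X) ≠ 0 := by
  rwa [Ne, comp_neg_X_eq_zero_iff]

theorem toAdd_eq_of_mul_comp_eq {φ : ℂ[X]} (h : φ ≠ 0) {x y : Multiplicative ℂ}
    (hxy : C x.toAdd * φ.comp (-X) = C y.toAdd * φ.comp (-X)) : x = y :=
  Multiplicative.toAdd.injective (C_injective (mul_right_cancel₀ (comp_neg_X_ne_zero h) hxy))

/-- `(d, e) ↦ (A ↦ A, B ↦ dB, X ↦ eX)`. -/
noncomputable def diagonalHom : ℂˣ × ℂˣ →* ((Fin 3 → ℂ[X]) ≃ₗ[ℂ[X]] (Fin 3 → ℂ[X])) :=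
  MonoidHom.mk' (fun x => triangular 1 x.1 x.2 0) fun x y => by simp [triangular_mul]

theorem diagonalHom_injective : Function.Injective diagonalHom := by
  intro x y h
  obtain ⟨-, h1, h2, -⟩ := triangular_inj h
  exact Prod.ext h1 h2

theorem theorem4p3 :
    -- `𝒜₁`
    (∀ (f : ℂ[X][Y]) (hf : IsSkewSymmetric f), f ≠ 0 →
      Nonempty ((algA1 f hf 0).Aut ≃* (Multiplicative ℂ[X] ⋊[scalarAction ℂ[X]] ℂˣ) × ℂˣ)) ∧
    (∀ (f : ℂ[X][Y]) (hf : IsSkewSymmetric f) (φ : ℂ[X]), f ≠ 0 → φ ≠ 0 →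
      Nonempty ((algA1 f hf φ).Aut ≃* Multiplicative ℂ[X] × ℂˣ)) ∧
    -- `𝒜₂`
    (∀ (f : ℂ[X][Y]) (hf : IsSkewSymmetric f), f ≠ 0 →
      Nonempty ((algA2 f hf 0).Aut ≃* (Multiplicative ℂ[X] ⋊[scalarAction ℂ[X]] ℂˣ) × ℂˣ)) ∧
    (∀ (f : ℂ[X][Y]) (hf : IsSkewSymmetric f) (ψ : ℂ[X]), f ≠ 0 → ψ ≠ 0 →
      Nonempty ((algA2 f hf ψ).Aut ≃*
        (Multiplicative ℂ[X] ⋊[scalarAction ℂ[X]] ℂˣ) × Multiplicative (ZMod 2))) ∧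
    -- `𝒜₃`
    (∀ φ : ℂ[X], φ ≠ 0 → Nonempty ((algA3 φ).Aut ≃* Multiplicative ℂ ⋊[squareAction] ℂˣ)) ∧
    -- `𝒜₄`
    (∀ p φ : ℂ[X], p ≠ 0 →
      Nonempty ((algA4 p φ).Aut ≃* (Multiplicative ℂ ⋊[scalarAction ℂ] ℂˣ) × ℂˣ)) ∧
    -- `ℬ₁`, `ℬ₂`
    (∀ α β : ℂ, Nonempty ((algB1 α β).Aut ≃* ℂˣ)) ∧
    Nonempty (algB2.Aut ≃* Multiplicative (ZMod 2)) ∧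
    -- `𝒞₁`, `𝒞₂`, `𝒞₃`
    (∀ α β : ℂ, Nonempty ((algC1 α β).Aut ≃* ℂˣ × ℂˣ)) ∧
    Nonempty (algC2.Aut ≃* ℂˣ × Multiplicative (ZMod 2)) ∧
    (∀ φ : ℂ[X], φ ≠ 0 → Nonempty ((algC3 φ).Aut ≃* ℂˣ)) := by
  refine ⟨fun f hf h0 => ?_, fun f hf φ h0 hφ => ?_, fun f hf h0 => ?_, fun f hf ψ h0 hψ => ?_,
    fun φ hφ => ?_, fun p φ hp => ?_, fun α β => ?_, ?_, fun α β => ?_, ?_, fun φ hφ => ?_⟩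
  · refine nonempty_mulEquiv_of_range (shearHom (MonoidHom.snd ℂˣ ℂˣ)) (shearHom_injective ?_) ?_
    · exact fun _ _ _ h => h
    · intro σ
      rw [mem_Aut_A1_iff hf h0, exists_shearHom_iff]
      simp only [true_or, and_true, MonoidHom.coe_snd, exists_eq]
  · refine nonempty_mulEquiv_of_range (MonoidHom.mk'
      (fun x : Multiplicative ℂ[X] × ℂˣ => triangular 1 1 x.2 x.1.toAdd) ?_) ?_ ?_
    · intro x y
      simp [triangular_mul]
    · intro x y h
      obtain ⟨-, -, h1, h2⟩ := triangular_inj h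
      exact Prod.ext h2 h1
    · intro σ
      rw [mem_Aut_A1_iff hf h0]
      constructor
      · rintro ⟨a, e, b, rfl, h | rfl⟩
        · exact absurd h hφ
        · exact ⟨(.ofAdd b, e), by simp⟩
      · rintro ⟨⟨b, e⟩, rfl⟩
        exact ⟨1, e, b.toAdd, by simp, Or.inr rfl⟩
  · refine nonempty_mulEquiv_of_range (shearHom (MonoidHom.snd ℂˣ ℂˣ)) (shearHom_injective ?_) ?_
    · exact fun _ _ _ h => h
    · intro σ
      rw [mem_Aut_A2_iff hf h0, exists_shearHom_iff]
      simp only [true_or, and_true, MonoidHom.coe_snd, exists_eq]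
  -- The condition `a² = e²` means `e = ±a`. Taking `a` times a sign as the scaling of `X` makes the
  -- sign an independent direct factor.
  · refine nonempty_mulEquiv_of_range
      (shearHom (MonoidHom.fst ℂˣ _ * signUnits.comp (MonoidHom.snd ℂˣ _)))
      (shearHom_injective ?_) ?_
    · exact fun _ _ _ h => signUnits_injective (mul_left_cancel h)
    · intro σ
      rw [mem_Aut_A2_iff hf h0, exists_shearHom_iff]
      have key : ∀ a e : ℂˣ, (∃ s, a * signUnits s = e) ↔ a * a = e * e := by
        intro a e
        have h : ∀ s, a * s = e ↔ s = a⁻¹ * e := fun s => eq_inv_mul_iff_mul_eq.symm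
        simp only [h, exists_signUnits_iff]
        rw [mul_mul_mul_comm, ← mul_inv, inv_mul_eq_one]
      simp only [hψ, false_or, ← key]
      rfl
  -- Here `a = 1` and `d = e²`, so the multiples of `φ(-∂)` compose by `z + e² z'`; this is the
  -- source of the squared action.
  · refine nonempty_mulEquiv_of_range (MonoidHom.mk'
      (fun x : Multiplicative ℂ ⋊[squareAction] ℂˣ =>
        triangular 1 (x.right * x.right) x.right (C x.left.toAdd * φ.comp (-X))) ?_) ?_ ?_
    · intro x y
      rw [triangular_mul]
      congr 1
      · simp
      · simp [mul_mul_mul_comm]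
      · simp [squareAction_apply]
        ring
    · intro x y h
      obtain ⟨-, -, h1, h2⟩ := triangular_inj h
      exact SemidirectProduct.ext (toAdd_eq_of_mul_comp_eq hφ h2) h1
    · intro σ
      rw [mem_Aut_A3_iff hφ]
      exact ⟨fun ⟨e, z, h⟩ => ⟨⟨.ofAdd z, e⟩, h⟩, fun ⟨⟨z, e⟩, h⟩ => ⟨e, z.toAdd, h⟩⟩
  -- Now `d` is independent of `e` and acts on `z` by plain scaling, while `e` splits off as a
  -- direct factor.
  · refine nonempty_mulEquiv_of_range (MonoidHom.mk'
      (fun x : (Multiplicative ℂ ⋊[scalarAction ℂ] ℂˣ) × ℂˣ =>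
        triangular 1 x.1.right x.2 (C x.1.left.toAdd * p.comp (-X))) ?_) ?_ ?_
    · intro x y
      rw [triangular_mul]
      congr 1
      · simp
      · simp [scalarAction_apply]
        ring
    · intro x y h
      obtain ⟨-, h3, h1, h2⟩ := triangular_inj h
      exact Prod.ext (SemidirectProduct.ext
        (toAdd_eq_of_mul_comp_eq hp h2) h3) h1
    · intro σ
      rw [mem_Aut_A4_iff hp]
      exact ⟨fun ⟨d, e, z, h⟩ => ⟨(⟨.ofAdd z, d⟩, e), h⟩,
        fun ⟨⟨⟨z, d⟩, e⟩, h⟩ => ⟨d, e, z.toAdd, h⟩⟩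
  · refine nonempty_mulEquiv_of_range (diagonalHom.comp (MonoidHom.inr ℂˣ ℂˣ)) ?_ ?_
    · exact diagonalHom_injective.comp (Prod.mk_right_injective (1 : ℂˣ))
    · exact mem_Aut_B1_iff α β
  · refine nonempty_mulEquiv_of_range
      (diagonalHom.comp ((MonoidHom.inr ℂˣ ℂˣ).comp signUnits)) ?_ ?_
    · exact diagonalHom_injective.comp ((Prod.mk_right_injective (1 : ℂˣ)).comp signUnits_injective)
    · intro σ
      simp only [mem_Aut_B2_iff, ← exists_signUnits_iff]
      constructor
      · rintro ⟨_, rfl, s, rfl⟩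
        exact ⟨s, rfl⟩
      · rintro ⟨s, rfl⟩
        exact ⟨_, rfl, s, rfl⟩
  · refine nonempty_mulEquiv_of_range diagonalHom diagonalHom_injective fun σ => ?_
    rw [mem_Aut_C1_iff]
    exact ⟨fun ⟨d, e, h⟩ => ⟨(d, e), h⟩, fun ⟨⟨d, e⟩, h⟩ => ⟨d, e, h⟩⟩
  · refine nonempty_mulEquiv_of_range
      (diagonalHom.comp ((MonoidHom.id ℂˣ).prodMap signUnits)) ?_ ?_
    · exact diagonalHom_injective.comp (Function.injective_id.prodMap signUnits_injective)
    · intro σ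
      simp only [mem_Aut_C2_iff, ← exists_signUnits_iff]
      constructor
      · rintro ⟨d, _, rfl, s, rfl⟩
        exact ⟨(d, s), rfl⟩
      · rintro ⟨⟨d, s⟩, rfl⟩
        exact ⟨d, _, rfl, s, rfl⟩
  · refine nonempty_mulEquiv_of_range (diagonalHom.comp (MonoidHom.inr ℂˣ ℂˣ)) ?_ ?_
    · exact diagonalHom_injective.comp (Prod.mk_right_injective (1 : ℂˣ))
    · exact mem_Aut_C3_iff hφ
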